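/- Let $A$ be a finite alphabet, $\mathbb N_0=\{0,1,2,\dots\}$, and $T$ the shift $(Ta)(i)=a(i+1)$ on the space $A^{\mathbb N_0}$ of one-sided sequences (with the product topology); write $a(j:j+n)$ for the word $a(j)a(j+1)\cdots a(j+n)$. Let $X\subset A^{\mathbb N_0}$ be a nonempty subshift (a compact set with $T(X)\subset X$), and let $\mathcal L_m(X)=\{a(0:m): a\in X\}$ be the set of its admissible words of length $m+1$. Assume that * $X$ is sofic: there are a finite alphabet $B$, a subshift of finite type $Y=\{y\in B^{\mathbb N_0}: y(j:j+n)\in L\ \text{for all } j\ge 0\}$ with some $n\ge 0$ and $L\subset B^{n+1}$, and a continuous map $\Pi:Y\to A^{\mathbb N_0}$ commuting with the shifts, such that $X=\Pi(Y)$; * $X$ is specified: there is $\ell\ge 0$ such that for all $a\in\mathcal L_m(X)$, $b\in\mathcal L_n(X)$ and all $k,k'\ge\ell$ there is $c\in X$ with $T^{(m+1)+k+(n+1)+k'}c=c$, $c(0:m)=a$ and $(T^{m+k+1}c)(0:n)=b$. Let $\varphi:A^{\mathbb N_0}\to\mathbb R$ be Hölder continuous: for some $C>0$ and $\theta\in[0,1)$,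 $|\varphi(a)-\varphi(b)|\le C\theta^m$ whenever $m\ge 0$ and $a(0:m)=b(0:m)$. Put $S_k\varphi=\sum_{i=0}^{k}\varphi\circ T^i$. A Gibbs measure for $\varphi$ on a subshift $Z$ is a $T$-invariant Borel probability measure $\mu$ concentrated on $Z$ for which there are constants $K>0$ and $P\in\mathbb R$ with $$K^{-1}\le\frac{\mu[a(0:k)]}{\exp\big(S_k\varphi(a)-(k+1)P\big)}\le K\qquad\text{for all } a\in Z,\ k\ge 0,$$ where $[w]$ is the cylinder of the word $w$. For $m\ge 1$ let $X_m=\{a\in A^{\mathbb N_0}: a(j:j+m)\in\mathcal L_m(X)\ \text{for all } j\ge 0\}\supset X$ be the finite type approximation of order $m$. Let $\mu_\varphi$ be the Gibbs measure for $\varphi$ on $X$, and $\mu_\varphi^m$ the Gibbs measure for $\varphi$ on $X_m$. Then there are constants $C_h>0$, $C_P>0$, $\theta_h\in(0,1)$ and $\theta_P\in(0,1)$, depending only on $X$ and $\varphi$, such that for every $m\ge 1$ the limits defining the entropies $$h(\nu)=-\lim_{n\to\infty}\frac1{n+1}\sum_{w\in A^{n+1}}\nu[w]\log\nu[w]\quad(\nu=\mu_\varphi,\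 \mu_\varphi^m;\ 0\log 0=0)$$ and the relative entropy $$h(\mu_\varphi\,|\,\mu_\varphi^m)=\lim_{n\to\infty}\frac1{n+1}\sum_{w\in\mathcal L_n(X_m)}\mu_\varphi[w]\log\frac{\mu_\varphi[w]}{\mu_\varphi^m[w]}$$ exist, and $$|h(\mu_\varphi)-h(\mu_\varphi^m)|\le C_h\,\theta_h^m,\qquad h(\mu_\varphi\,|\,\mu_\varphi^m)\le\frac{C_P}{1-\theta_P}\,\theta_P^m .$$ -/

import Mathlib

open Set Filter Topology MeasureTheory

namespace SoficGibbs

/-- The shift transformation on one-sided sequences, `(T a)(i) = a(i+1)`. -/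
def shift {A : Type*} (x : ℕ → A) : ℕ → A := fun i => x (i + 1)

/-- The word `x(j : j+n) = x(j) x(j+1) ⋯ x(j+n)`, of length `n + 1`. -/
def word {A : Type*} (x : ℕ → A) (j n : ℕ) : Fin (n + 1) → A := fun i => x (j + i)

/-- A subshift of `A^ℕ`: a compact set which is invariant under the shift. -/
def IsSubshift {A : Type*} [TopologicalSpace A] (X : Set (ℕ → A)) : Prop :=
  IsCompact X ∧ MapsTo shift X X

/-- The `X`-admissible words of length `m + 1`. -/
def admissible {A : Type*} (X : Set (ℕ → A)) (m : ℕ) : Set (Fin (m + 1) → A) :=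
  {w | ∃ x ∈ X, word x 0 m = w}

/-- The subshift of finite type defined by a collection `L` of words of length `n + 1`. -/
def sft {A : Type*} {n : ℕ} (L : Set (Fin (n + 1) → A)) : Set (ℕ → A) :=
  {x | ∀ j : ℕ, word x j n ∈ L}

/-- A sofic subshift: the image of a subshift of finite type (over some finite alphabet)
under a continuous map that commutes with the shift. -/
def IsSofic {A : Type*} [TopologicalSpace A] (X : Set (ℕ → A)) : Prop :=
  ∃ (q n : ℕ) (L : Set (Fin (n + 1) → Fin q)) (f : (ℕ → Fin q) → (ℕ → A)),
    ContinuousOn f (sft L) ∧ (∀ y ∈ sft L, f (shift y) = shift (f y)) ∧ X = f '' sft L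

/-- The specification property: there is `ℓ` such that any two `X`-admissible words `a`, `b` and
any two gaps `k, k' ≥ ℓ` are realized by a periodic point of `X` that reads `a`, then `k` letters,
then `b`, then `k'` letters, and then repeats. -/
def IsSpecified {A : Type*} (X : Set (ℕ → A)) : Prop :=
  ∃ l : ℕ, ∀ m n : ℕ, ∀ a ∈ admissible X m, ∀ b ∈ admissible X n, ∀ k k' : ℕ, l ≤ k → l ≤ k' →
    ∃ c ∈ X, shift^[(m + 1) + k + (n + 1) + k'] c = c ∧
      word c 0 m = a ∧ word (shift^[m + k + 1] c) 0 n = b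

/-- The finite type approximation of order `m` to `X`. -/
def ftApprox {A : Type*} (X : Set (ℕ → A)) (m : ℕ) : Set (ℕ → A) := sft (admissible X m)

/-- Hölder continuity of a potential: for some `C > 0` and `θ ∈ [0,1)`, the potential varies by at
most `C θ ^ m` on sequences that agree in the coordinates `0, …, m`. -/
def IsHolder {A : Type*} (φ : (ℕ → A) → ℝ) : Prop :=
  ∃ C θ : ℝ, 0 < C ∧ 0 ≤ θ ∧ θ < 1 ∧
    ∀ (m : ℕ) (x y : ℕ → A), word x 0 m = word y 0 m → |φ x - φ y| ≤ C * θ ^ m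

/-- The Birkhoff sum `S_k φ = ∑_{i=0}^{k} φ ∘ T^i` (it has `k + 1` terms). -/
def birkhoff {A : Type*} (φ : (ℕ → A) → ℝ) (k : ℕ) (x : ℕ → A) : ℝ :=
  ∑ i ∈ Finset.range (k + 1), φ (shift^[i] x)

/-- The cylinder of a word, as a subset of `A^ℕ`. It is only measured by measures that are
concentrated on the subshift under consideration. -/
def cyl {A : Type*} {n : ℕ} (w : Fin (n + 1) → A) : Set (ℕ → A) := {x | word x 0 n = w}

/-- `μ` is a Gibbs measure on `X` for the potential `φ`: a shift-invariant Borel probability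
measure concentrated on `X` that satisfies the Gibbs inequality at every point of `X`. -/
def IsGibbs {A : Type*} [MeasurableSpace A] (X : Set (ℕ → A)) (φ : (ℕ → A) → ℝ)
    (μ : Measure (ℕ → A)) : Prop :=
  IsProbabilityMeasure μ ∧ MeasurePreserving shift μ μ ∧ (∀ᵐ x ∂μ, x ∈ X) ∧
    ∃ C P : ℝ, 0 < C ∧ ∀ x ∈ X, ∀ k : ℕ,
      C⁻¹ ≤ μ.real (cyl (word x 0 k)) / Real.exp (birkhoff φ k x - (k + 1) * P) ∧
      μ.real (cyl (word x 0 k)) / Real.exp (birkhoff φ k x - (k + 1) * P) ≤ C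

/-- The measure-theoretic entropy `h(ν)` exists as a limit and equals `h`
(with `0 log 0 = 0`, so that all words may be included in the sum). -/
def HasEntropy {A : Type*} [Fintype A] [MeasurableSpace A] (ν : Measure (ℕ → A)) (h : ℝ) : Prop :=
  Tendsto (fun n : ℕ => -(1 / ((n : ℝ) + 1)) *
    ∑ w : Fin (n + 1) → A, ν.real (cyl w) * Real.log (ν.real (cyl w))) atTop (𝓝 h)

open scoped Classical in
/-- The relative entropy `h(ν | μ)` exists as a limit and equals `r`, where `μ` is a measure on
the subshift `Y` that charges all cylinders of `Y`, and `ν` is concentrated on a subset of `Y`. -/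
def HasRelEntropy {A : Type*} [Fintype A] [MeasurableSpace A] (Y : Set (ℕ → A))
    (ν μ : Measure (ℕ → A)) (r : ℝ) : Prop :=
  Tendsto (fun n : ℕ => 1 / ((n : ℝ) + 1) *
    ∑ w : Fin (n + 1) → A with w ∈ admissible Y n,
      ν.real (cyl w) * Real.log (ν.real (cyl w) / μ.real (cyl w))) atTop (𝓝 r)

end SoficGibbs

open SoficGibbs

namespace SoficGibbs

/-! Everything is expressed through weighted sums over words. With `S` the Birkhoff sum of `φ` read
off a word (`suffixSum`), a Gibbs measure gives a word `w` the mass `exp (S w - |w| P)` up to a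
constant. Hence its entropy is `P - I` with `I = ∫ φ`, and the relative entropy of two Gibbs
measures for `φ` is the difference of their pressures. It remains to compare pressures and integrals
for `X` and `X_m`; only the Gibbs inequality is used, not existence or uniqueness.

Pressures. A sofic shift has finitely many follower sets, and a word with a minimal one is
synchronizing (`exists_isSync`). A locally admissible word that is not admissible has a maximal
admissible suffix, and a synchronizing word `v` cannot occur in the first `m` letters of that suffix
(`mem_avoidingStart`). By specification, avoiding `v` for `m` letters has relative weight `O(ρ^m)`
(`exists_avoiding_le`), and a renewal inequality then gives `P(X_m) ≤ P(X) + K ρ^m`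
(`exists_part_localLang_le`).

Integrals. Let `P(s)` be the pressure of `s φ` on `X`. By Jensen's inequality
(`IsGibbsWeights.le_rate`), `I` and `I'` are slopes of supporting lines of `P` at `1`, the second up
to an error `K ρ^m`, so `ε (I' - I) ≤ P(1+ε) + P(1-ε) - 2 P(1) + K ρ^m`. Analyticity of `P` is not
needed, only a bound on its second differences. For a potential of memory `k` this bound is `O((ε
k)^2)`: regeneration at `v` confines the conditional means of `S` to an interval of length `O(k)`
(`exists_osc_bound`), and an Azuma-Hoeffding argument controls the exponential moments
(`sum_exp_le`). Truncating `φ` to memory `m` costs `O(θ^m)`, and an exponentially small `ε` balances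
all terms (`exists_exponential_bound`). -/

/-- The finite set of all words of length `n`. -/
noncomputable def words (A : Type*) [Finite A] (n : ℕ) : Finset (List A) :=
  (List.finite_length_eq A n).toFinset

/-! ### Sums over words and concatenation. -/

section Words

variable {A : Type*} [Finite A]

@[simp] lemma mem_words {n : ℕ} {w : List A} : w ∈ words A n ↔ w.length = n := by
  simp [words]

lemma words_zero : words A 0 = {[]} := by
  ext w; simp

lemma sum_words_add {M : Type*} [AddCommMonoid M] (n p : ℕ) (f : List A → M) :
    ∑ w ∈ words A (n + p), f w = ∑ a ∈ words A n, ∑ b ∈ words A p, f (a ++ b) := by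
  rw [← Finset.sum_product']
  symm
  refine Finset.sum_bij' (fun x _ => x.1 ++ x.2) (fun w _ => (w.take n, w.drop n)) ?_ ?_ ?_ ?_ ?_
  · rintro ⟨a, b⟩ h
    simp only [Finset.mem_product, mem_words] at h
    simp [h.1, h.2]
  · intro w h
    simp only [mem_words] at h
    simp [h]
  · rintro ⟨a, b⟩ h
    simp only [Finset.mem_product, mem_words] at h
    simp [← h.1]
  · intro w h
    simp
  · rintro ⟨a, b⟩ h
    rfl

lemma sum_words_one {M : Type*} [AddCommMonoid M] [Fintype A] (f : List A → M) :
    ∑ w ∈ words A 1, f w = ∑ a : A, f [a] := by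
  symm
  refine Finset.sum_bij (fun a _ => [a]) (by simp) (by simp) ?_ (by simp)
  intro w hw
  rw [mem_words, List.length_eq_one_iff] at hw
  obtain ⟨a, rfl⟩ := hw
  exact ⟨a, Finset.mem_univ _, rfl⟩

lemma card_words [Fintype A] (n : ℕ) : (words A n).card = Fintype.card A ^ n := by
  induction n with
  | zero => simp [words_zero]
  | succ n ih =>
    have h := sum_words_add (A := A) n 1 (fun _ => 1)
    simp only [Finset.sum_const, smul_eq_mul, mul_one] at h
    have h1 := sum_words_one (A := A) (fun _ => 1)
    simp only [Finset.sum_const, smul_eq_mul, mul_one, Finset.card_univ] at h1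
    rw [h, ih, h1, pow_succ]

end Words

/-! ### Partition functions of languages with gluing. -/

/-- A factorial language with words of every length, any two of whose words can be glued with a gap
of length `l`. -/
structure IsGluing {A : Type*} (L : Set (List A)) (l : ℕ) : Prop where
  left : ∀ {a b}, a ++ b ∈ L → a ∈ L
  right : ∀ {a b}, a ++ b ∈ L → b ∈ L
  exists_length : ∀ n, ∃ w ∈ L, w.length = n
  glue : ∀ {a b}, a ∈ L → b ∈ L → ∃ g, g.length = l ∧ a ++ (g ++ b) ∈ L

/-- An almost additive function on words. -/
structure AlmostAdditive {A : Type*} (D F : ℝ) (S : List A → ℝ) : Prop where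
  abs_le : ∀ w, |S w| ≤ F * w.length
  abs_append : ∀ a b, |S (a ++ b) - (S a + S b)| ≤ D

open scoped Classical in
/-- The weight of a word of the language `L`. -/
noncomputable def wt {A : Type*} (L : Set (List A)) (S : List A → ℝ) (w : List A) : ℝ :=
  if w ∈ L then Real.exp (S w) else 0

/-- The partition function of a language. -/
noncomputable def part {A : Type*} [Finite A] (L : Set (List A)) (S : List A → ℝ) (n : ℕ) : ℝ :=
  ∑ w ∈ words A n, wt L S w

/-- The partition function over the words of length `n + |a|` ending with `a`. -/
noncomputable def ext {A : Type*} [Finite A] (L : Set (List A)) (S : List A → ℝ) (n : ℕ)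
    (a : List A) : ℝ :=
  ∑ b ∈ words A n, wt L S (b ++ a)

section Language

variable {A : Type*} {L : Set (List A)} {S : List A → ℝ} {D F : ℝ} {l : ℕ}

lemma wt_of_mem {w : List A} (h : w ∈ L) : wt L S w = Real.exp (S w) := if_pos h

lemma wt_of_notMem {w : List A} (h : w ∉ L) : wt L S w = 0 := if_neg h

lemma wt_nonneg (w : List A) : 0 ≤ wt L S w := by
  unfold wt; split_ifs <;> positivity

lemma wt_mono {L' : Set (List A)} (h : L ⊆ L') (w : List A) : wt L S w ≤ wt L' S w := by
  by_cases hw : w ∈ L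
  · rw [wt_of_mem hw, wt_of_mem (h hw)]
  · rw [wt_of_notMem hw]; exact wt_nonneg w

lemma AlmostAdditive.D_nonneg (hS : AlmostAdditive D F S) : 0 ≤ D :=
  (abs_nonneg _).trans (hS.abs_append [] [])

lemma AlmostAdditive.le (hS : AlmostAdditive D F S) (a b : List A) :
    S (a ++ b) ≤ D + (S a + S b) := by
  have := (_root_.abs_le.1 (hS.abs_append a b)).2; linarith

lemma AlmostAdditive.ge (hS : AlmostAdditive D F S) (a b : List A) :
    S a + S b ≤ D + S (a ++ b) := by
  have := (_root_.abs_le.1 (hS.abs_append a b)).1; linarith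

lemma AlmostAdditive.nil (hS : AlmostAdditive D F S) : S [] = 0 := by
  have := hS.abs_le []; simpa using this

lemma AlmostAdditive.F_nonneg (hS : AlmostAdditive D F S) (hL : IsGluing L l) : 0 ≤ F := by
  obtain ⟨w, -, hw⟩ := hL.exists_length 1
  have := (abs_nonneg _).trans (hS.abs_le w)
  simpa [hw] using this

lemma AlmostAdditive.mono {D' F' : ℝ} (hS : AlmostAdditive D F S) (hD : D ≤ D') (hF : F ≤ F') :
    AlmostAdditive D' F' S :=
  ⟨fun w => (hS.abs_le w).trans (by gcongr), fun a b => (hS.abs_append a b).trans hD⟩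

lemma AlmostAdditive.const_mul (hS : AlmostAdditive D F S) (s : ℝ) :
    AlmostAdditive (|s| * D) (|s| * F) (fun w => s * S w) := by
  refine ⟨fun w => ?_, fun a b => ?_⟩
  · rw [abs_mul, mul_assoc]; gcongr; exact hS.abs_le w
  · rw [← mul_add, ← mul_sub, abs_mul]; gcongr; exact hS.abs_append a b

lemma wt_append_le (hS : AlmostAdditive D F S) (hl : ∀ {a b}, a ++ b ∈ L → a ∈ L)
    (hr : ∀ {a b}, a ++ b ∈ L → b ∈ L) (a b : List A) :
    wt L S (a ++ b) ≤ Real.exp D * (wt L S a * wt L S b) := by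
  by_cases h : a ++ b ∈ L
  · rw [wt_of_mem h, wt_of_mem (hl h), wt_of_mem (hr h), ← Real.exp_add, ← Real.exp_add]
    exact Real.exp_le_exp.2 (hS.le a b)
  · rw [wt_of_notMem h]
    have := wt_nonneg (L := L) (S := S) a
    have := wt_nonneg (L := L) (S := S) b
    positivity

variable [Finite A]

lemma part_nonneg (n : ℕ) : 0 ≤ part L S n := Finset.sum_nonneg fun w _ => wt_nonneg w

lemma ext_nonneg (n : ℕ) (a : List A) : 0 ≤ ext L S n a := Finset.sum_nonneg fun _ _ => wt_nonneg _

lemma part_add_le (hS : AlmostAdditive D F S) (hl : ∀ {a b}, a ++ b ∈ L → a ∈ L)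
    (hr : ∀ {a b}, a ++ b ∈ L → b ∈ L) (n p : ℕ) :
    part L S (n + p) ≤ Real.exp D * (part L S n * part L S p) := by
  rw [part, sum_words_add, part, part, Finset.sum_mul_sum, Finset.mul_sum]
  refine Finset.sum_le_sum fun a _ => ?_
  rw [Finset.mul_sum]
  exact Finset.sum_le_sum fun b _ => wt_append_le hS hl hr a b

lemma ext_le (hS : AlmostAdditive D F S) (hL : IsGluing L l) (n : ℕ) (a : List A) :
    ext L S n a ≤ Real.exp D * (part L S n * wt L S a) := by
  rw [part, ext, Finset.sum_mul, Finset.mul_sum]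
  exact Finset.sum_le_sum fun b _ => wt_append_le hS hL.left hL.right b a

lemma part_pos (hL : IsGluing L l) (n : ℕ) : 0 < part L S n := by
  obtain ⟨w, hw, hn⟩ := hL.exists_length n
  refine Finset.sum_pos' (fun w _ => wt_nonneg w) ⟨w, by simpa using hn, ?_⟩
  rw [wt_of_mem hw]; positivity

lemma part_le [Fintype A] (hS : AlmostAdditive D F S) (n : ℕ) :
    part L S n ≤ Fintype.card A ^ n * Real.exp (F * n) := by
  have : ∀ w ∈ words A n, wt L S w ≤ Real.exp (F * n) := by
    intro w hw
    rw [mem_words] at hw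
    unfold wt
    split_ifs
    · refine Real.exp_le_exp.2 ((le_abs_self _).trans ?_)
      rw [← hw]; exact hS.abs_le w
    · positivity
  refine (Finset.sum_le_card_nsmul _ _ _ this).trans_eq ?_
  rw [card_words]; simp

/-- One gluing word `g` suffices: its insertion lowers `S` by at most `2 * D + F * l`. -/
lemma le_sum_glue (hS : AlmostAdditive D F S) (hL : IsGluing L l) (a b : List A) :
    Real.exp (-(2 * D + F * l)) * (wt L S a * wt L S b) ≤
      ∑ g ∈ words A l, wt L S (a ++ (g ++ b)) := by
  have h0 : 0 ≤ ∑ g ∈ words A l, wt L S (a ++ (g ++ b)) :=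
    Finset.sum_nonneg fun g _ => wt_nonneg _
  by_cases ha : a ∈ L
  · by_cases hb : b ∈ L
    · obtain ⟨g, hg, h⟩ := hL.glue ha hb
      refine le_trans ?_ (Finset.single_le_sum (f := fun g => wt L S (a ++ (g ++ b)))
        (fun g _ => wt_nonneg _) (mem_words.2 hg))
      rw [wt_of_mem ha, wt_of_mem hb, wt_of_mem h, ← Real.exp_add, ← Real.exp_add]
      refine Real.exp_le_exp.2 ?_
      have h1 := hS.ge a (g ++ b)
      have h2 := hS.ge g b
      have h3 := (_root_.abs_le.1 (hS.abs_le g)).1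
      rw [hg] at h3
      linarith
    · simpa [wt_of_notMem hb] using h0
  · simpa [wt_of_notMem ha] using h0

/-- Extensions of a word have, up to a uniform constant, the weight predicted by independence. -/
lemma exists_le_ext [Fintype A] (hL : IsGluing L l) (D F : ℝ) :
    ∃ c > 0, ∀ S, AlmostAdditive D F S → ∀ n a, c * (part L S n * wt L S a) ≤ ext L S n a := by
  have hcard : 0 < (Fintype.card A : ℝ) ^ l := by
    obtain ⟨w, -, hw⟩ := hL.exists_length 1
    obtain ⟨x, -⟩ := List.length_eq_one_iff.1 hw
    have : Nonempty A := ⟨x⟩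
    have : 0 < Fintype.card A := Fintype.card_pos
    positivity
  set M := Fintype.card A ^ l * Real.exp (F * l)
  refine ⟨Real.exp (-(2 * D + F * l)) / (Real.exp D * M), by positivity, fun S hS n a => ?_⟩
  rw [div_mul_eq_mul_div, div_le_iff₀ (by positivity)]
  -- Gluing bounds the extensions of length `n + l` from below; discarding the `l` letters farthest
  -- from `a` then costs only the bounded factor `M`.
  have h1 : Real.exp (-(2 * D + F * l)) * (part L S n * wt L S a) ≤ ext L S (n + l) a := by
    rw [ext, sum_words_add, part, Finset.sum_mul, Finset.mul_sum]
    refine Finset.sum_le_sum fun b _ => ?_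
    simpa using le_sum_glue hS hL b a
  have h2 : ext L S (n + l) a ≤ Real.exp D * (part L S l * ext L S n a) := by
    rw [add_comm, ext, sum_words_add, part, ext, Finset.sum_mul_sum, Finset.mul_sum]
    refine Finset.sum_le_sum fun b _ => ?_
    rw [Finset.mul_sum]
    refine Finset.sum_le_sum fun g _ => ?_
    rw [List.append_assoc]
    exact wt_append_le hS hL.left hL.right _ _
  have h3 := part_le (L := L) hS l
  calc _ ≤ _ := h1.trans h2
    _ ≤ Real.exp D * (M * ext L S n a) := by
      gcongr; exact ext_nonneg _ _
    _ = _ := by ring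

lemma exists_le_part_add [Fintype A] (hL : IsGluing L l) (D F : ℝ) :
    ∃ c > 0, ∀ S, AlmostAdditive D F S → ∀ n p,
      c * (part L S n * part L S p) ≤ part L S (n + p) := by
  obtain ⟨c, hc, h⟩ := exists_le_ext hL D F
  refine ⟨c, hc, fun S hS n p => ?_⟩
  rw [part, part, part, sum_words_add, Finset.sum_comm, Finset.mul_sum, Finset.mul_sum]
  exact Finset.sum_le_sum fun a _ => h S hS n a

end Language

/-! ### Growth rates and pressure. -/

/-- A positive sequence that is multiplicative up to constants has an exponential growth rate. -/
lemma exists_growth_rate {c K : ℝ} (hc : 0 < c) (hK : 0 < K) {u : ℕ → ℝ} (hu : ∀ n, 0 < u n)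
    (h1 : ∀ n p, u (n + p) ≤ K * (u n * u p)) (h2 : ∀ n p, c * (u n * u p) ≤ u (n + p))
    (hu0 : u 0 = 1) :
    ∃ P : ℝ, ∀ n : ℕ, K⁻¹ * Real.exp (n * P) ≤ u n ∧ u n ≤ c⁻¹ * Real.exp (n * P) := by
  have hl1 : ∀ n p, Real.log (u (n + p)) ≤ Real.log K + (Real.log (u n) + Real.log (u p)) := by
    intro n p
    rw [← Real.log_mul (hu n).ne' (hu p).ne', ← Real.log_mul hK.ne' (by have := hu n; have := hu p; positivity)]
    exact Real.log_le_log (hu _) (h1 n p)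
  have hl2 : ∀ n p, Real.log c + (Real.log (u n) + Real.log (u p)) ≤ Real.log (u (n + p)) := by
    intro n p
    have := hu n
    have := hu p
    rw [← Real.log_mul (hu n).ne' (hu p).ne', ← Real.log_mul hc.ne' (by positivity)]
    exact Real.log_le_log (by positivity) (h2 n p)
  -- Fekete's lemma applies to `log u + log K` and to `-(log u + log c)`. The two limits are
  -- opposite, and bounding each limit by the individual terms gives the two-sided estimate.
  have s1 : Subadditive fun n => Real.log (u n) + Real.log K := fun n p => by
    have := hl1 n p; simp only; linarith
  have s2 : Subadditive fun n => -(Real.log (u n) + Real.log c) := fun n p => by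
    have := hl2 n p; simp only; linarith
  have low : ∀ n : ℕ, n * (Real.log (u 1) + Real.log c) ≤ Real.log (u n) + Real.log c ∨ n = 0 := by
    intro n
    induction n with
    | zero => right; rfl
    | succ n ih =>
      left
      rcases ih with ih | rfl
      · have := hl2 n 1; push_cast; linarith
      · simp
  have up : ∀ n : ℕ, Real.log (u n) + Real.log K ≤ n * (Real.log (u 1) + Real.log K) ∨ n = 0 := by
    intro n
    induction n with
    | zero => right; rfl
    | succ n ih =>
      left
      rcases ih with ih | rfl
      · have := hl1 n 1; push_cast; linarith
      · simp
  have b1 : BddBelow (range fun n : ℕ => (Real.log (u n) + Real.log K) / n) := by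
    -- The index `n = 0` contributes `x / 0 = 0`, hence the `min 0`.
    refine ⟨min 0 (Real.log (u 1) + Real.log c + min 0 (Real.log K - Real.log c)), ?_⟩
    rintro _ ⟨n, rfl⟩
    rcases low n with h | rfl
    · rcases Nat.eq_zero_or_pos n with rfl | hn
      · simp
      · refine (min_le_right _ _).trans ?_
        have hn' : (1 : ℝ) ≤ n := by exact_mod_cast hn
        simp only
        rw [le_div_iff₀ (by positivity)]
        have h3 := min_le_left 0 (Real.log K - Real.log c)
        have h4 := min_le_right 0 (Real.log K - Real.log c)
        nlinarith
    · simp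
  have b2 : BddBelow (range fun n : ℕ => -(Real.log (u n) + Real.log c) / n) := by
    refine ⟨min 0 (-(Real.log (u 1) + Real.log K) + min 0 (Real.log K - Real.log c)), ?_⟩
    rintro _ ⟨n, rfl⟩
    rcases up n with h | rfl
    · rcases Nat.eq_zero_or_pos n with rfl | hn
      · simp
      · refine (min_le_right _ _).trans ?_
        have hn' : (1 : ℝ) ≤ n := by exact_mod_cast hn
        simp only
        rw [le_div_iff₀ (by positivity)]
        have h3 := min_le_left 0 (Real.log K - Real.log c)
        have h4 := min_le_right 0 (Real.log K - Real.log c)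
        nlinarith
    · simp
  have t1 := s1.tendsto_lim b1
  have t2 := s2.tendsto_lim b2
  have hlim : s2.lim = -s1.lim := by
    refine tendsto_nhds_unique t2 ?_
    have t3 : Tendsto (fun n : ℕ => (Real.log K - Real.log c) / (n : ℝ)) atTop (𝓝 0) :=
      tendsto_const_div_atTop_nhds_zero_nat _
    have := t3.sub t1
    rw [zero_sub] at this
    refine this.congr fun n => ?_
    rw [← sub_div]; congr 1; ring
  refine ⟨s1.lim, fun n => ?_⟩
  rcases Nat.eq_zero_or_pos n with rfl | hn
  · have e1 := h1 0 0
    have e2 := h2 0 0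
    simp only [hu0, mul_one, add_zero] at e1 e2
    simp only [hu0, Nat.cast_zero, zero_mul, Real.exp_zero, mul_one]
    exact ⟨inv_le_one_of_one_le₀ e1, (one_le_inv₀ hc).2 e2⟩
  have hn' : (0 : ℝ) < n := by exact_mod_cast hn
  have i1 := s1.lim_le_div b1 hn.ne'
  have i2 := s2.lim_le_div b2 hn.ne'
  rw [hlim] at i2
  rw [le_div_iff₀ hn'] at i1 i2
  constructor
  · rw [inv_mul_le_iff₀ hK, ← Real.log_le_log_iff (by positivity) (by have := hu n; positivity),
      Real.log_exp, Real.log_mul hK.ne' (hu n).ne']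
    linarith
  · rw [le_inv_mul_iff₀ hc, ← Real.log_le_log_iff (by have := hu n; positivity) (by positivity),
      Real.log_exp, Real.log_mul hc.ne' (hu n).ne']
    linarith

/-- `P` is the exponential growth rate of `u`, with constant `K`. -/
def HasRate (u : ℕ → ℝ) (K P : ℝ) : Prop :=
  ∀ n : ℕ, K⁻¹ * Real.exp (n * P) ≤ u n ∧ u n ≤ K * Real.exp (n * P)

/-- The pressure exists, with a multiplicative error that is uniform over the potentials. -/
lemma exists_pressure {A : Type*} [Fintype A] {L : Set (List A)} {l : ℕ} (hL : IsGluing L l)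
    (D F : ℝ) :
    ∃ K > 0, ∀ S, AlmostAdditive D F S → ∃ P, HasRate (part L S) K P := by
  obtain ⟨c, hc, h⟩ := exists_le_part_add hL D F
  refine ⟨max (Real.exp D) c⁻¹, lt_max_of_lt_left (by positivity), fun S hS => ?_⟩
  obtain ⟨P, hP⟩ := exists_growth_rate hc (Real.exp_pos D) (part_pos (S := S) hL)
    (fun n p => part_add_le hS hL.left hL.right n p) (fun n p => h S hS n p) (by
      obtain ⟨w, hw, h0⟩ := hL.exists_length 0
      rw [List.length_eq_zero_iff] at h0
      rw [part, words_zero, Finset.sum_singleton, wt_of_mem (h0 ▸ hw), hS.nil, Real.exp_zero])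
  refine ⟨P, fun n => ⟨le_trans ?_ (hP n).1, (hP n).2.trans ?_⟩⟩
  · gcongr
    exact le_max_left _ _
  · gcongr
    exact le_max_right _ _

/-- Comparison of growth rates. -/
lemma rate_le_of_forall {c K P Q : ℝ} (hc : 0 < c)
    (h : ∀ n : ℕ, c * Real.exp (n * P) ≤ K * Real.exp (n * Q)) : P ≤ Q := by
  have hK : 0 < K := by
    have := h 0
    simp only [Nat.cast_zero, zero_mul, Real.exp_zero, mul_one] at this
    linarith
  by_contra! hlt
  obtain ⟨n, hn⟩ := exists_nat_gt ((Real.log K - Real.log c) / (P - Q))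
  rw [div_lt_iff₀ (by linarith)] at hn
  have := Real.log_le_log (by positivity) (h n)
  rw [Real.log_mul hc.ne' (Real.exp_ne_zero _), Real.log_mul hK.ne' (Real.exp_ne_zero _),
    Real.log_exp, Real.log_exp] at this
  linarith

/-! ### Synchronizing words and the pressure of finite type approximations. -/

section Avoiding

variable {A : Type*} {L : Set (List A)} {l : ℕ}

/-- The words of `L` in which `v` does not occur. -/
def avoiding (L : Set (List A)) (v : List A) : Set (List A) := {w | w ∈ L ∧ ¬ v <:+: w}

open scoped Classical in
/-- The partition function over words of length `n + r` whose last `n` letters avoid `v`. -/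
noncomputable def avoidingEnd [Finite A] (L : Set (List A)) (S : List A → ℝ) (v : List A)
    (n r : ℕ) : ℝ :=
  ∑ a ∈ words A n, if v <:+: a then 0 else ext L S r a

lemma avoidingEnd_zero_right [Finite A] (S : List A → ℝ) (v : List A) (n : ℕ) :
    avoidingEnd L S v n 0 = part (avoiding L v) S n := by
  refine Finset.sum_congr rfl fun a _ => ?_
  rw [ext, words_zero, Finset.sum_singleton, List.nil_append]
  by_cases hv : v <:+: a
  · rw [if_pos hv, wt_of_notMem (fun h => h.2 hv)]
  · rw [if_neg hv]
    by_cases ha : a ∈ L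
    · rw [wt_of_mem ha, wt_of_mem (show a ∈ avoiding L v from ⟨ha, hv⟩)]
    · rw [wt_of_notMem ha, wt_of_notMem (fun h => ha h.1)]

lemma avoidingEnd_le_part [Finite A] (S : List A → ℝ) (v : List A) (n r : ℕ) :
    avoidingEnd L S v n r ≤ part L S (r + n) := by
  rw [part, sum_words_add, Finset.sum_comm, avoidingEnd]
  refine Finset.sum_le_sum fun a _ => ?_
  split_ifs
  · exact Finset.sum_nonneg fun _ _ => wt_nonneg _
  · rfl

variable [Fintype A]

/-- Forbidding one more occurrence of `v` costs a uniform factor. -/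
lemma exists_avoidingEnd_le (hL : IsGluing L l) {v : List A} (hv : v ∈ L) (D F : ℝ) :
    ∃ c > 0, c < 1 ∧ ∀ S, AlmostAdditive D F S → ∀ n r,
      avoidingEnd L S v (v.length + l + n) r ≤
        (1 - c) * avoidingEnd L S v n (r + (v.length + l)) := by
  classical
  obtain ⟨c₀, hc₀, hext⟩ := exists_le_ext hL D F
  have hcard : 0 < (Fintype.card A : ℝ) := by
    obtain ⟨w, -, hw⟩ := hL.exists_length 1
    obtain ⟨x, -⟩ := List.length_eq_one_iff.1 hw
    have : Nonempty A := ⟨x⟩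
    have : 0 < Fintype.card A := Fintype.card_pos
    positivity
  set N := v.length + l with hN
  set M : ℝ := Real.exp D * Real.exp D * (Fintype.card A ^ N * Real.exp (F * N)) with hM
  have hMpos : 0 < M := by positivity
  set c₁ : ℝ := Real.exp (-(2 * D + F * l)) * c₀ * Real.exp (-(F * v.length)) / M with hc₁
  have hc₁pos : 0 < c₁ := by positivity
  refine ⟨min c₁ (1 / 2), by positivity, by have := min_le_right c₁ (1 / 2); linarith,
    fun S hS n r => ?_⟩
  -- A fixed proportion of the weight of the extensions of `a` by `r + N` letters lies on those that
  -- read `v` and a gap of length `l` right before `a`.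
  have key : ∀ a, c₁ * ext L S (r + N) a ≤ ∑ g ∈ words A l, ext L S r (v ++ (g ++ a)) := by
    intro a
    have e1 : ext L S (r + N) a ≤ M * (part L S r * wt L S a) := by
      refine (ext_le hS hL _ _).trans ?_
      have h1 := part_add_le hS hL.left hL.right r N
      have h2 := part_le (L := L) hS N
      have h3 := wt_nonneg (L := L) (S := S) a
      have h4 := part_nonneg (L := L) (S := S) r
      calc Real.exp D * (part L S (r + N) * wt L S a)
          ≤ Real.exp D * ((Real.exp D * (part L S r * (Fintype.card A ^ N * Real.exp (F * N))))
            * wt L S a) := by gcongr; exact h1.trans (by gcongr)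
        _ = _ := by rw [hM]; ring
    have e2 : Real.exp (-(2 * D + F * l)) * (ext L S r v * wt L S a) ≤
        ∑ g ∈ words A l, ext L S r (v ++ (g ++ a)) := by
      simp only [ext]
      rw [Finset.sum_comm, Finset.sum_mul, Finset.mul_sum]
      refine Finset.sum_le_sum fun b _ => ?_
      simpa using le_sum_glue hS hL (b ++ v) a
    have e3 : Real.exp (-(F * v.length)) ≤ wt L S v := by
      rw [wt_of_mem hv]
      exact Real.exp_le_exp.2 (abs_le.1 (hS.abs_le v)).1
    have h3 := wt_nonneg (L := L) (S := S) a
    have h4 := part_nonneg (L := L) (S := S) r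
    calc c₁ * ext L S (r + N) a ≤ c₁ * (M * (part L S r * wt L S a)) := by gcongr
      _ = Real.exp (-(2 * D + F * l)) *
          (c₀ * (part L S r * Real.exp (-(F * v.length))) * wt L S a) := by
        rw [hc₁]; field_simp
      _ ≤ Real.exp (-(2 * D + F * l)) * (ext L S r v * wt L S a) := by
        gcongr
        refine le_trans ?_ (hext S hS r v)
        gcongr
      _ ≤ _ := e2
  rw [avoidingEnd, avoidingEnd, sum_words_add, Finset.sum_comm, Finset.mul_sum]
  refine Finset.sum_le_sum fun a _ => ?_
  by_cases ha : v <:+: a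
  · rw [if_pos ha, mul_zero]
    refine (Finset.sum_eq_zero fun d _ => ?_).le
    rw [if_pos (ha.trans (List.suffix_append d a).isInfix)]
  rw [if_neg ha]
  have tot : ext L S (r + N) a =
      ∑ d₁ ∈ words A v.length, ∑ g ∈ words A l, ext L S r (d₁ ++ (g ++ a)) := by
    rw [ext, sum_words_add, Finset.sum_comm, hN, sum_words_add]
    simp [ext]
  rw [hN, sum_words_add]
  have hvw : v ∈ words A v.length := by simp
  calc ∑ d₁ ∈ words A v.length, ∑ g ∈ words A l,
        (if v <:+: d₁ ++ g ++ a then 0 else ext L S r (d₁ ++ g ++ a))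
      ≤ ∑ d₁ ∈ (words A v.length).erase v, ∑ g ∈ words A l, ext L S r (d₁ ++ (g ++ a)) := by
        rw [← Finset.add_sum_erase _ _ hvw]
        have : ∑ g ∈ words A l, (if v <:+: v ++ g ++ a then 0 else ext L S r (v ++ g ++ a)) = 0 :=
          Finset.sum_eq_zero fun g _ => by
            rw [if_pos]; rw [List.append_assoc]; exact (List.prefix_append _ _).isInfix
        rw [this, zero_add]
        refine Finset.sum_le_sum fun d _ => Finset.sum_le_sum fun g _ => ?_
        rw [List.append_assoc]
        split_ifs
        · exact ext_nonneg _ _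
        · rfl
    _ = ext L S (r + N) a - ∑ g ∈ words A l, ext L S r (v ++ (g ++ a)) := by
        rw [Finset.sum_erase_eq_sub hvw, tot]
    _ ≤ _ := by
        have h1 := key a
        have h2 : min c₁ (1 / 2) * ext L S (r + N) a ≤ c₁ * ext L S (r + N) a := by
          gcongr
          · exact ext_nonneg _ _
          · exact min_le_left _ _
        rw [← hN]
        linarith

/-- The words avoiding `v` have exponentially small weight. -/
lemma exists_avoiding_le (hL : IsGluing L l) {v : List A} (hv : v ∈ L) (D F : ℝ) :
    ∃ K > 0, ∃ ρ > 0, ρ < 1 ∧ ∀ S, AlmostAdditive D F S → ∀ m,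
      part (avoiding L v) S m ≤ K * ρ ^ m * part L S m := by
  -- For `v = []` the block length `N` could be zero, but then no word avoids `v`.
  rcases eq_or_ne v [] with rfl | hne
  · refine ⟨1, one_pos, 1 / 2, by norm_num, by norm_num, fun S hS m => ?_⟩
    have : part (avoiding L []) S m = 0 :=
      Finset.sum_eq_zero fun w _ => wt_of_notMem fun h => h.2 w.nil_infix
    rw [this]
    have := part_nonneg (L := L) (S := S) m
    positivity
  obtain ⟨c, hc, hc1, h⟩ := exists_avoidingEnd_le hL hv D F
  set N := v.length + l
  have hN : N ≠ 0 := by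
    have := List.length_pos_iff.2 hne
    omega
  have h1c : 0 < 1 - c := by linarith
  set ρ : ℝ := (1 - c) ^ ((N : ℝ)⁻¹) with hρ
  have hρN : ρ ^ N = 1 - c := Real.rpow_inv_natCast_pow h1c.le hN
  have hρ0 : 0 < ρ := by positivity
  have hρ1 : ρ < 1 := Real.rpow_lt_one h1c.le (by linarith) (by positivity)
  -- The factor `(1 - c)⁻¹` pays for the incomplete block of `m % N` letters.
  refine ⟨(1 - c)⁻¹, by positivity, ρ, hρ0, hρ1, fun S hS m => ?_⟩
  -- Each step turns a block of `N` letters avoiding `v` into unconstrained ones. The total length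
  -- is unchanged, so the final comparison is with `part L S m`.
  have iter : ∀ j i r, avoidingEnd L S v (j * N + i) r ≤
      (1 - c) ^ j * avoidingEnd L S v i (r + j * N) := by
    intro j
    induction j with
    | zero => intro i r; simp
    | succ j ih =>
      intro i r
      have e1 := h S hS (j * N + i) r
      have e2 := ih i (r + N)
      rw [show (j + 1) * N + i = N + (j * N + i) by ring,
        show r + (j + 1) * N = r + N + j * N by ring]
      refine e1.trans ?_
      rw [pow_succ', mul_assoc]
      gcongr
  have e := (iter (m / N) (m % N) 0).trans
    (mul_le_mul_of_nonneg_left (avoidingEnd_le_part S v _ _) (by positivity))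
  have hm : m / N * N + m % N = m := Nat.div_add_mod' m N
  rw [zero_add, hm, avoidingEnd_zero_right] at e
  refine e.trans ?_
  gcongr
  · exact part_nonneg _
  · rw [le_inv_mul_iff₀ h1c, ← pow_succ', ← hρN, ← pow_mul]
    refine pow_le_pow_of_le_one hρ0.le hρ1.le ?_
    have := Nat.mod_lt m (Nat.pos_of_ne_zero hN)
    rw [mul_add, mul_one, mul_comm N]
    omega

/-- The words all of whose subwords of length at most `m + 1` are in `L`. -/
def localLang (L : Set (List A)) (m : ℕ) : Set (List A) :=
  {w | ∀ u, u <:+: w → u.length ≤ m + 1 → u ∈ L}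

omit [Fintype A] in
lemma mem_or_exists_maximal_suffix (h : [] ∈ L) (w : List A) :
    w ∈ L ∨ ∃ b x a, w = b ++ x :: a ∧ a ∈ L ∧ x :: a ∉ L := by
  induction w with
  | nil => exact Or.inl h
  | cons y w ih =>
    rcases ih with hw | ⟨b, x, a, rfl, ha, hxa⟩
    · by_cases hy : y :: w ∈ L
      · exact Or.inl hy
      · exact Or.inr ⟨[], y, w, rfl, hw, hy⟩
    · exact Or.inr ⟨y :: b, x, a, rfl, ha, hxa⟩

/-- `v` is a synchronizing word of `L`. -/
def IsSync (L : Set (List A)) (v : List A) : Prop :=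
  v ∈ L ∧ ∀ a b, a ++ v ∈ L → v ++ b ∈ L → a ++ (v ++ b) ∈ L

/-- The words of `L` whose first `m` letters avoid `v`, and which have at least one more letter. -/
def avoidingStart (L : Set (List A)) (v : List A) (m : ℕ) : Set (List A) :=
  {a | a ∈ L ∧ m + 1 ≤ a.length ∧ ¬ v <:+: a.take m}

-- If `a` had at most `m` letters, locality would put `x :: a` in `L`. If `v` ended within the first
-- `m` letters of `a`, the part of `x :: a` up to the end of `v` would have at most `m + 1` letters,
-- hence lie in `L`, and synchronization would join it to the rest of `a`.
omit [Fintype A] in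
lemma mem_avoidingStart (hL : IsGluing L l) {v : List A} (hv : IsSync L v) {m : ℕ} {x : A}
    {b a : List A} (hw : b ++ x :: a ∈ localLang L m) (ha : a ∈ L) (hxa : x :: a ∉ L) :
    a ∈ avoidingStart L v m := by
  refine ⟨ha, ?_, ?_⟩
  · by_contra! hlt
    exact hxa (hw _ (List.suffix_append b (x :: a)).isInfix (by simp; omega))
  · rintro ⟨p, q, hpq⟩
    have h1 : a = p ++ (v ++ (q ++ a.drop m)) := by
      conv_lhs => rw [← List.take_append_drop m a, ← hpq]
      simp
    have h2 : (x :: p) ++ v ∈ L := by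
      refine hw _ ⟨b, q ++ a.drop m, ?_⟩ ?_
      · conv_rhs => rw [h1]
        simp
      · have := congrArg List.length hpq
        simp only [List.length_append, List.length_take] at this
        simp only [List.length_append, List.length_cons]
        omega
    have h3 : v ++ (q ++ a.drop m) ∈ L := by
      rw [h1] at ha
      exact hL.right ha
    have := hv.2 _ _ h2 h3
    rw [List.cons_append, ← h1] at this
    exact hxa this

omit [Fintype A] in
lemma localLang_of_infix {m : ℕ} {u w : List A} (hw : w ∈ localLang L m) (h : u <:+: w) :
    u ∈ localLang L m := fun _ hu => hw _ (hu.trans h)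

lemma sum_words_take_drop {n q : ℕ} (hq : q ≤ n) (f g : List A → ℝ) :
    ∑ w ∈ words A n, f (w.take q) * g (w.drop q) =
      (∑ a ∈ words A q, f a) * ∑ b ∈ words A (n - q), g b := by
  obtain ⟨p, rfl⟩ := Nat.exists_eq_add_of_le hq
  rw [sum_words_add, Nat.add_sub_cancel_left, Finset.sum_mul_sum]
  refine Finset.sum_congr rfl fun a ha => Finset.sum_congr rfl fun b _ => ?_
  rw [mem_words] at ha
  simp [← ha]

/-- A renewal inequality: a word outside `L` is cut just after the letter preceding its maximal
suffix in `L`. The left piece is still locally admissible, the right one is in `avoidingStart L v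
m`, and `q` is the position of the cut. -/
lemma part_localLang_le {S : List A → ℝ} {D F : ℝ} (hS : AlmostAdditive D F S) (hL : IsGluing L l)
    {v : List A} (hv : IsSync L v) (m n : ℕ) :
    part (localLang L m) S n ≤ part L S n + Real.exp D * ∑ q ∈ Finset.range n,
      part (localLang L m) S q * part (avoidingStart L v m) S (n - q) := by
  have hnil : [] ∈ L := by
    obtain ⟨w, hw, h0⟩ := hL.exists_length 0
    rwa [List.length_eq_zero_iff.1 h0] at hw
  have e : ∑ q ∈ Finset.range n,
      part (localLang L m) S q * part (avoidingStart L v m) S (n - q) =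
      ∑ w ∈ words A n, ∑ q ∈ Finset.range n,
        wt (localLang L m) S (w.take q) * wt (avoidingStart L v m) S (w.drop q) := by
    rw [Finset.sum_comm]
    refine Finset.sum_congr rfl fun q hq => ?_
    rw [sum_words_take_drop (Finset.mem_range.1 hq).le]
    rfl
  rw [e, part, part, Finset.mul_sum, ← Finset.sum_add_distrib]
  refine Finset.sum_le_sum fun w hw => ?_
  rw [mem_words] at hw
  have hnn : ∀ q, 0 ≤ wt (localLang L m) S (w.take q) * wt (avoidingStart L v m) S (w.drop q) :=
    fun q => mul_nonneg (wt_nonneg _) (wt_nonneg _)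
  have hs : 0 ≤ ∑ q ∈ Finset.range n,
      wt (localLang L m) S (w.take q) * wt (avoidingStart L v m) S (w.drop q) :=
    Finset.sum_nonneg fun q _ => hnn q
  by_cases hwm : w ∈ localLang L m
  swap
  · rw [wt_of_notMem hwm]
    exact add_nonneg (wt_nonneg _) (mul_nonneg (Real.exp_pos _).le hs)
  rcases mem_or_exists_maximal_suffix hnil w with hwL | ⟨b, x, a, rfl, ha, hxa⟩
  · rw [wt_of_mem hwm, wt_of_mem hwL]
    exact le_add_of_nonneg_right (mul_nonneg (Real.exp_pos _).le hs)
  have hbad := mem_avoidingStart hL hv hwm ha hxa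
  refine le_trans ?_ (le_add_of_nonneg_left (wt_nonneg _))
  have hb : b ++ [x] ∈ localLang L m :=
    localLang_of_infix hwm ⟨[], a, by simp⟩
  have hlen : (b ++ [x]).length < n := by
    have := hbad.2.1
    simp only [List.length_append, List.length_cons, List.length_nil] at hw ⊢
    omega
  calc wt (localLang L m) S (b ++ x :: a)
      ≤ Real.exp D * (wt (localLang L m) S (b ++ [x]) * wt (avoidingStart L v m) S a) := by
        rw [wt_of_mem hwm, wt_of_mem hb, wt_of_mem hbad, ← Real.exp_add, ← Real.exp_add]
        refine Real.exp_le_exp.2 ?_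
        have := hS.le (b ++ [x]) a
        simpa using this
    _ ≤ _ := by
        gcongr
        have := Finset.single_le_sum (fun q _ => hnn q) (Finset.mem_range.2 hlen)
        refine le_trans (le_of_eq ?_) this
        congr 2
        · rw [show b ++ x :: a = (b ++ [x]) ++ a by simp, List.take_left' rfl]
        · rw [show b ++ x :: a = (b ++ [x]) ++ a by simp, List.drop_left' rfl]

/-- The first `m` letters avoid `v` and the others are free. For `p ≤ m` there are no such words; in
the other case `m ≤ p` is recorded so that the truncated subtraction `p - m` is genuine. -/
lemma part_avoidingStart_le {S : List A → ℝ} {D F : ℝ} (hS : AlmostAdditive D F S)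
    (hL : IsGluing L l) (v : List A) (m p : ℕ) :
    part (avoidingStart L v m) S p = 0 ∨
    part (avoidingStart L v m) S p ≤
      Real.exp D * (part (avoiding L v) S m * part L S (p - m)) ∧ m ≤ p := by
  by_cases hp : m + 1 ≤ p
  · right
    refine ⟨?_, by omega⟩
    obtain ⟨i, rfl⟩ := Nat.exists_eq_add_of_le (show m ≤ p by omega)
    rw [Nat.add_sub_cancel_left, part, part, part, sum_words_add, Finset.sum_mul_sum,
      Finset.mul_sum]
    refine Finset.sum_le_sum fun a ha => ?_
    rw [Finset.mul_sum]
    refine Finset.sum_le_sum fun b _ => ?_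
    rw [mem_words] at ha
    by_cases h : a ++ b ∈ avoidingStart L v m
    · have h1 : a ∈ avoiding L v := by
        refine ⟨hL.left h.1, ?_⟩
        have := h.2.2
        rwa [List.take_left' ha] at this
      rw [wt_of_mem h, wt_of_mem h1, wt_of_mem (hL.right h.1), ← Real.exp_add, ← Real.exp_add]
      exact Real.exp_le_exp.2 (hS.le a b)
    · rw [wt_of_notMem h]
      exact mul_nonneg (Real.exp_pos _).le (mul_nonneg (wt_nonneg _) (wt_nonneg _))
  · left
    refine Finset.sum_eq_zero fun w hw => wt_of_notMem fun h => hp ?_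
    rw [mem_words] at hw
    rw [← hw]
    exact h.2.1

/-- The pressure of the finite type approximations is exponentially close to that of `L`. -/
lemma exists_part_localLang_le (hL : IsGluing L l) {v : List A} (hv : IsSync L v) (D F : ℝ) :
    ∃ K > 0, ∃ ρ > 0, ρ < 1 ∧ ∀ S, AlmostAdditive D F S → ∃ P, HasRate (part L S) K P ∧
      ∀ m n : ℕ, part (localLang L m) S n ≤ K * Real.exp (n * (P + K * ρ ^ m)) := by
  obtain ⟨K₁, hK₁, hP⟩ := exists_pressure hL D F
  obtain ⟨K₂, hK₂, ρ, hρ, hρ1, hav⟩ := exists_avoiding_le hL hv.1 D F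
  set K₃ := Real.exp D * (Real.exp D * (K₂ * K₁ * K₁)) with hK₃
  have hK₃p : 0 < K₃ := by positivity
  set K := max K₁ K₃
  refine ⟨K, lt_max_of_lt_left hK₁, ρ, hρ, hρ1, fun S hS => ?_⟩
  obtain ⟨P, hr⟩ := hP S hS
  refine ⟨P, fun n => ⟨le_trans ?_ (hr n).1, (hr n).2.trans ?_⟩, fun m n => ?_⟩
  · gcongr; exact le_max_left _ _
  · gcongr; exact le_max_left _ _
  set t := K₃ * ρ ^ m with ht
  have ht0 : 0 < t := by positivity
  have hbad : ∀ p, Real.exp D * part (avoidingStart L v m) S p ≤ t * Real.exp (p * P) := by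
    intro p
    rcases part_avoidingStart_le hS hL v m p with h | ⟨h, hmp⟩
    · rw [h, mul_zero]; positivity
    · have h1 := hav S hS m
      have h2 := (hr m).2
      have h3 := (hr (p - m)).2
      have h4 : Real.exp (p * P) = Real.exp (m * P) * Real.exp ((p - m : ℕ) * P) := by
        rw [← Real.exp_add, Nat.cast_sub hmp]; congr 1; ring
      have h5 := part_nonneg (L := L) (S := S) (p - m)
      calc _ ≤ Real.exp D * (Real.exp D * ((K₂ * ρ ^ m * (K₁ * Real.exp (m * P))) *
            (K₁ * Real.exp ((p - m : ℕ) * P)))) := by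
            gcongr
            refine h.trans ?_
            gcongr
            exact h1.trans (by gcongr)
        _ = _ := by rw [ht, hK₃, h4]; ring
  -- The renewal inequality is solved by the identity `1 + t * ∑ q < n, (1 + t) ^ q = (1 + t) ^ n`.
  have main : ∀ n, part (localLang L m) S n ≤ K₁ * Real.exp (n * P) * (1 + t) ^ n := by
    intro n
    induction n using Nat.strong_induction_on with
    | _ n ih =>
      refine (part_localLang_le hS hL hv m n).trans ?_
      rw [Finset.mul_sum]
      have hs : ∑ q ∈ Finset.range n, Real.exp D *
          (part (localLang L m) S q * part (avoidingStart L v m) S (n - q)) ≤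
          ∑ q ∈ Finset.range n, K₁ * Real.exp (n * P) * (t * (1 + t) ^ q) := by
        refine Finset.sum_le_sum fun q hq => ?_
        have hq' := Finset.mem_range.1 hq
        have h4 : Real.exp (n * P) = Real.exp (q * P) * Real.exp ((n - q : ℕ) * P) := by
          rw [← Real.exp_add, Nat.cast_sub hq'.le]; congr 1; ring
        have h6 := hbad (n - q)
        have h7 := part_nonneg (L := avoidingStart L v m) (S := S) (n - q)
        calc _ = part (localLang L m) S q *
              (Real.exp D * part (avoidingStart L v m) S (n - q)) := by ring
          _ ≤ (K₁ * Real.exp (q * P) * (1 + t) ^ q) * (t * Real.exp ((n - q : ℕ) * P)) := by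
              gcongr
              exact ih q hq'
          _ = _ := by rw [h4]; ring
      refine (add_le_add (hr n).2 hs).trans (le_of_eq ?_)
      rw [← Finset.mul_sum, ← Finset.mul_sum]
      have := geom_sum_mul (1 + t) n
      have e : t * ∑ i ∈ Finset.range n, (1 + t) ^ i = (1 + t) ^ n - 1 := by
        rw [← this]; ring
      rw [e]; ring
  refine (main n).trans ?_
  have h1 : (1 + t) ^ n ≤ Real.exp (n * t) := by
    rw [Real.exp_nat_mul]
    gcongr
    rw [add_comm]; exact Real.add_one_le_exp t
  have h2 : K₃ ≤ K := le_max_right _ _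
  have h3 : K₁ ≤ K := le_max_left _ _
  calc _ ≤ K * Real.exp (n * P) * Real.exp (n * t) := by gcongr
    _ = K * Real.exp (n * (P + t)) := by rw [mul_assoc, ← Real.exp_add, mul_add]
    _ ≤ _ := by
      have : t ≤ K * ρ ^ m := by rw [ht]; gcongr
      have hK : 0 < K := lt_max_of_lt_left hK₁
      gcongr

end Avoiding

/-! ### Second differences of the pressure for finite memory. -/

section SecondOrder

variable {A : Type*} {L : Set (List A)} {l : ℕ}

/-- The increments of `S` on prepending a word depend only on `k` letters of the tail. -/
def HasMemory (k : ℕ) (S : List A → ℝ) : Prop :=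
  ∀ b w w' : List A, k ≤ w.length → k ≤ w'.length → w.take k = w'.take k →
    S (b ++ w) - S w = S (b ++ w') - S w'

/-- The weighted sum of the increments of `S` over the extensions of `w` by `n` letters. -/
noncomputable def extSum [Finite A] (L : Set (List A)) (S : List A → ℝ) (n : ℕ)
    (w : List A) : ℝ :=
  ∑ b ∈ words A n, wt L S (b ++ w) * (S (b ++ w) - S w)

variable {S : List A → ℝ} {D F : ℝ}

lemma IsGluing.wt_append_eq_zero (hL : IsGluing L l) {w : List A} (hw : w ∉ L) (b : List A) :
    wt L S (b ++ w) = 0 := wt_of_notMem fun h => hw (hL.right h)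

section

variable [Finite A]

lemma ext_of_notMem (hL : IsGluing L l) {w : List A} (hw : w ∉ L) (n : ℕ) : ext L S n w = 0 :=
  Finset.sum_eq_zero fun b _ => hL.wt_append_eq_zero hw b

lemma extSum_of_notMem (hL : IsGluing L l) {w : List A} (hw : w ∉ L) (n : ℕ) :
    extSum L S n w = 0 :=
  Finset.sum_eq_zero fun b _ => by rw [hL.wt_append_eq_zero hw b, zero_mul]

lemma ext_add (n p : ℕ) (w : List A) :
    ext L S (n + p) w = ∑ c ∈ words A p, ext L S n (c ++ w) := by
  rw [ext, sum_words_add, Finset.sum_comm]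
  simp [ext]

lemma extSum_add (n p : ℕ) (w : List A) :
    extSum L S (n + p) w =
      ∑ c ∈ words A p, (extSum L S n (c ++ w) + ext L S n (c ++ w) * (S (c ++ w) - S w)) := by
  rw [extSum, sum_words_add, Finset.sum_comm]
  refine Finset.sum_congr rfl fun c _ => ?_
  rw [extSum, ext, Finset.sum_mul, ← Finset.sum_add_distrib]
  refine Finset.sum_congr rfl fun b _ => ?_
  rw [List.append_assoc]; ring

omit [Finite A] in
lemma AlmostAdditive.abs_increment_le (hS : AlmostAdditive D F S) (b w : List A) :
    |S (b ++ w) - S w| ≤ D + F * b.length := by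
  have h1 := hS.abs_append b w
  have h2 := hS.abs_le b
  rw [_root_.abs_le] at *
  constructor <;> linarith

lemma abs_extSum_le (hS : AlmostAdditive D F S) (n : ℕ) (w : List A) :
    |extSum L S n w| ≤ (D + F * n) * ext L S n w := by
  refine (Finset.abs_sum_le_sum_abs _ _).trans ?_
  rw [ext, Finset.mul_sum]
  refine Finset.sum_le_sum fun b hb => ?_
  rw [mem_words] at hb
  rw [abs_mul, abs_of_nonneg (wt_nonneg _), mul_comm, ← hb]
  gcongr
  · exact wt_nonneg _
  · exact hS.abs_increment_le b w

omit [Finite A] in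
/-- After a synchronizing word preceded by `k` letters, the past depends only on these. -/
lemma wt_sync (hL : IsGluing L l) {v : List A} (hv : IsSync L v) {k : ℕ} (hm : HasMemory k S)
    {t u : List A} (ht : t.length = k) (h : t ++ (v ++ u) ∈ L) (b : List A) :
    wt L S (b ++ (t ++ (v ++ u))) =
        Real.exp (S (t ++ (v ++ u)) - S (t ++ v)) * wt L S (b ++ (t ++ v)) ∧
      S (b ++ (t ++ (v ++ u))) - S (t ++ (v ++ u)) = S (b ++ (t ++ v)) - S (t ++ v) := by
  have e : S (b ++ (t ++ (v ++ u))) - S (t ++ (v ++ u)) = S (b ++ (t ++ v)) - S (t ++ v) := by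
    refine hm _ _ _ (by simp [ht]) (by simp [ht]) ?_
    rw [List.take_left' ht, List.take_left' ht]
  refine ⟨?_, e⟩
  by_cases hb : b ++ (t ++ v) ∈ L
  · have hb' : b ++ (t ++ (v ++ u)) ∈ L := by
      have := hv.2 (b ++ t) u (by simpa using hb) (hL.right h)
      simpa using this
    rw [wt_of_mem hb, wt_of_mem hb', ← Real.exp_add]
    congr 1; linarith
  · have hb' : b ++ (t ++ (v ++ u)) ∉ L := fun h' => hb (hL.left (b := u) (by simpa using h'))
    rw [wt_of_notMem hb, wt_of_notMem hb', mul_zero]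

/-- A Doeblin minorization for a nonnegative combination of `ext` and `extSum`. -/
lemma minorization (hS : AlmostAdditive D F S) (hL : IsGluing L l) {v : List A} (hv : IsSync L v)
    {k : ℕ} (hm : HasMemory k S) (n : ℕ) (α σ : ℝ)
    (h0 : ∀ w ∈ L, k ≤ w.length → 0 ≤ α * ext L S n w + σ * extSum L S n w) (w : List A) :
    Real.exp (-(2 * D + F * l)) * wt L S w *
        (α * ext L S (n + k) v + σ * ∑ t ∈ words A k, extSum L S n (t ++ v)) ≤
      ∑ c ∈ words A (k + (v.length + l)),
        (α * ext L S n (c ++ w) + σ * extSum L S n (c ++ w)) := by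
  set h : List A → ℝ := fun w => α * ext L S n w + σ * extSum L S n w with hh
  have hnn : ∀ w, k ≤ w.length → 0 ≤ h w := by
    intro w hk
    by_cases hw : w ∈ L
    · exact h0 w hw hk
    · simp [hh, ext_of_notMem hL hw, extSum_of_notMem hL hw]
  -- Seen from the past, everything after `t ++ v` is forgotten: changing `u` only multiplies `h` by
  -- a factor.
  have scale : ∀ t u : List A, t.length = k → t ++ (v ++ u) ∈ L →
      h (t ++ (v ++ u)) = Real.exp (S (t ++ (v ++ u)) - S (t ++ v)) * h (t ++ v) := by
    intro t u ht hu
    have e1 : ext L S n (t ++ (v ++ u)) =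
        Real.exp (S (t ++ (v ++ u)) - S (t ++ v)) * ext L S n (t ++ v) := by
      rw [ext, ext, Finset.mul_sum]
      exact Finset.sum_congr rfl fun b _ => (wt_sync hL hv hm ht hu b).1
    have e2 : extSum L S n (t ++ (v ++ u)) =
        Real.exp (S (t ++ (v ++ u)) - S (t ++ v)) * extSum L S n (t ++ v) := by
      rw [extSum, extSum, Finset.mul_sum]
      refine Finset.sum_congr rfl fun b _ => ?_
      rw [(wt_sync hL hv hm ht hu b).1, (wt_sync hL hv hm ht hu b).2, mul_assoc]
    simp only [hh, e1, e2]; ring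
  rw [ext_add, Finset.mul_sum, Finset.mul_sum, ← Finset.sum_add_distrib, Finset.mul_sum,
    sum_words_add]
  refine Finset.sum_le_sum fun t ht => ?_
  rw [mem_words] at ht
  have hc : ∀ c : List A, k ≤ (t ++ c ++ w).length := fun c => by simp [ht]
  have hsum : 0 ≤ ∑ b ∈ words A (v.length + l), h (t ++ b ++ w) :=
    Finset.sum_nonneg fun b _ => hnn _ (hc b)
  change _ * h (t ++ v) ≤ ∑ b ∈ words A (v.length + l), h (t ++ b ++ w)
  by_cases hw : w ∈ L
  swap
  · rw [wt_of_notMem hw, mul_zero, zero_mul]; exact hsum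
  by_cases htv : t ++ v ∈ L
  swap
  · have : h (t ++ v) = 0 := by simp [hh, ext_of_notMem hL htv, extSum_of_notMem hL htv]
    rw [this, mul_zero]; exact hsum
  -- All terms are nonnegative, so only `c = t ++ v ++ g` is kept.
  obtain ⟨g, hg, hgl⟩ := hL.glue htv hw
  have hgl' : t ++ (v ++ (g ++ w)) ∈ L := by simpa using hgl
  refine le_trans ?_ (Finset.single_le_sum (f := fun b => h (t ++ b ++ w))
    (fun b _ => hnn _ (hc b)) (a := v ++ g) (by simp [hg]))
  have e : t ++ (v ++ g) ++ w = t ++ (v ++ (g ++ w)) := by simp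
  rw [e, scale t (g ++ w) ht hgl']
  refine mul_le_mul_of_nonneg_right ?_ (hnn _ (by simp [ht]))
  rw [wt_of_mem hw, ← Real.exp_add]
  refine Real.exp_le_exp.2 ?_
  have h1 := hS.ge (t ++ v) (g ++ w)
  have h2 := hS.ge g w
  have h3 := (_root_.abs_le.1 (hS.abs_le g)).1
  rw [hg] at h3
  rw [List.append_assoc] at h1
  linarith

end

variable [Fintype A]

/-- The conditional means of the increments oscillate by at most a multiple of the memory. -/
lemma exists_osc_bound (hL : IsGluing L l) {v : List A} (hv : IsSync L v) (D F : ℝ) :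
    ∃ β > 0, ∀ k : ℕ, 0 < k → ∀ S, AlmostAdditive D F S → HasMemory k S → ∀ n, ∃ a, ∀ w ∈ L,
      k ≤ w.length → a * ext L S n w ≤ extSum L S n w ∧
        extSum L S n w ≤ (a + β * k) * ext L S n w := by
  obtain ⟨c₀, hc₀, hext⟩ := exists_le_ext hL D F
  have hcard : 0 < (Fintype.card A : ℝ) := by
    obtain ⟨w, -, hw⟩ := hL.exists_length 1
    obtain ⟨x, -⟩ := List.length_eq_one_iff.1 hw
    have : Nonempty A := ⟨x⟩
    have : 0 < Fintype.card A := Fintype.card_pos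
    positivity
  set M : ℝ := Real.exp D * Real.exp D *
    (Fintype.card A ^ (v.length + l) * Real.exp (F * (v.length + l : ℕ))) with hM
  have hMpos : 0 < M := by positivity
  set γ₀ : ℝ := Real.exp (-(2 * D + F * l)) * (c₀ * Real.exp (-(F * v.length))) / M with hγ₀
  have hγ₀p : 0 < γ₀ := by positivity
  set γ := min γ₀ 1
  have hγ : 0 < γ := by positivity
  have hγ1 : γ ≤ 1 := min_le_right _ _
  -- This constant makes `2 * T ≤ γ * B`, so that the width `B` survives the recursion `B ↦ (1 - γ)
  -- * B + 2 * T`. It is linear in `k` because `T` grows like the block length `N`.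
  refine ⟨2 * (|D| + |F| * (1 + v.length + l) + 1) / γ, by positivity,
    fun k hk S hS hm n => ?_⟩
  set B : ℝ := 2 * (|D| + |F| * (1 + v.length + l) + 1) / γ * k with hB
  set N := k + (v.length + l) with hN
  set T : ℝ := D + F * N with hT
  have hD := hS.D_nonneg
  have hF := hS.F_nonneg hL
  have hk1 : (1 : ℝ) ≤ k := by exact_mod_cast hk
  have hTB : 2 * T ≤ γ * B := by
    have : γ * B = 2 * (|D| + |F| * (1 + v.length + l) + 1) * k := by
      rw [hB]; field_simp
    rw [this, hT, hN, abs_of_nonneg hD, abs_of_nonneg hF]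
    push_cast
    have h1 : D ≤ D * k := le_mul_of_one_le_right hD hk1
    have h2 : F * (v.length + l) ≤ F * (v.length + l) * k :=
      le_mul_of_one_le_right (by positivity) hk1
    nlinarith
  have hB0 : 0 ≤ B := by positivity
  have hT0 : 0 ≤ T := by positivity
  have hTB' : 2 * T ≤ B := hTB.trans (mul_le_of_le_one_left hB0 hγ1)
  induction n using Nat.strong_induction_on with
  | _ n ih =>
    rcases lt_or_ge n N with hn | hn
    · refine ⟨-T, fun w hw _ => ?_⟩
      have h1 := _root_.abs_le.1 (abs_extSum_le (L := L) hS n w)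
      have h2 : (D + F * n) * ext L S n w ≤ T * ext L S n w := by
        have := ext_nonneg (L := L) (S := S) n w
        have : (n : ℝ) ≤ N := by exact_mod_cast hn.le
        rw [hT]; gcongr
      have h3 : 0 ≤ (B - 2 * T) * ext L S n w :=
        mul_nonneg (by linarith) (ext_nonneg _ _)
      constructor
      · linarith [h1.1]
      · linarith [h1.2]
    obtain ⟨r, rfl⟩ := Nat.exists_eq_add_of_le' hn
    obtain ⟨a, ha⟩ := ih r (by omega)
    set E := ext L S (r + k) v with hE
    set Y := ∑ t ∈ words A k, extSum L S r (t ++ v) with hY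
    have hpr : 0 < part L S (r + k) := part_pos hL _
    have hvwt : Real.exp (-(F * v.length)) ≤ wt L S v := by
      rw [wt_of_mem hv.1]
      exact Real.exp_le_exp.2 (_root_.abs_le.1 (hS.abs_le v)).1
    have hEge : c₀ * Real.exp (-(F * v.length)) * part L S (r + k) ≤ E := by
      refine le_trans ?_ (hext S hS (r + k) v)
      rw [mul_assoc, mul_comm (Real.exp _)]
      gcongr
    have hEpos : 0 < E := lt_of_lt_of_le (by positivity) hEge
    have hbound : ∀ w, γ * ext L S (r + N) w ≤
        Real.exp (-(2 * D + F * l)) * wt L S w * E := by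
      intro w
      have hw := wt_nonneg (L := L) (S := S) w
      have e1 : ext L S (r + N) w ≤ M * (part L S (r + k) * wt L S w) := by
        refine (ext_le hS hL _ _).trans ?_
        have h1 := part_add_le hS hL.left hL.right (r + k) (v.length + l)
        have h2 := part_le (L := L) hS (v.length + l)
        calc Real.exp D * (part L S (r + N) * wt L S w)
            ≤ Real.exp D * ((Real.exp D * (part L S (r + k) *
              (Fintype.card A ^ (v.length + l) * Real.exp (F * (v.length + l : ℕ)))))
              * wt L S w) := by
              gcongr
              rw [hN, ← add_assoc]
              exact h1.trans (by gcongr)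
          _ = _ := by rw [hM]; ring
      calc γ * ext L S (r + N) w ≤ γ₀ * (M * (part L S (r + k) * wt L S w)) := by
            gcongr
            · exact ext_nonneg _ _
            · exact min_le_left _ _
        _ = Real.exp (-(2 * D + F * l)) * wt L S w *
            (c₀ * Real.exp (-(F * v.length)) * part L S (r + k)) := by
            rw [hγ₀]; field_simp
        _ ≤ _ := by gcongr
    set y := Y / E with hy
    have hYE : Y = y * E := by rw [hy]; field_simp
    have htv : ∀ t ∈ words A k, a * ext L S r (t ++ v) ≤ extSum L S r (t ++ v) ∧
        extSum L S r (t ++ v) ≤ (a + B) * ext L S r (t ++ v) := by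
      intro t ht
      rw [mem_words] at ht
      by_cases h : t ++ v ∈ L
      · exact ha _ h (by simp [ht])
      · simp [ext_of_notMem hL h, extSum_of_notMem hL h]
    have hEsum : E = ∑ t ∈ words A k, ext L S r (t ++ v) := ext_add _ _ _
    have hy1 : a ≤ y := by
      rw [hy, le_div_iff₀ hEpos, hEsum, Finset.mul_sum]
      exact Finset.sum_le_sum fun t ht => (htv t ht).1
    have hy2 : y ≤ a + B := by
      rw [hy, div_le_iff₀ hEpos, hEsum, Finset.mul_sum]
      exact Finset.sum_le_sum fun t ht => (htv t ht).2
    -- A fraction `γ` of the weight regenerates at `v`, with a mean `y` that does not depend on `w`;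
    -- on the rest the mean lies in `[a, a + B]`; the `N` letters next to `w` add at most `T` in
    -- absolute value. The lower and upper bounds come from `minorization` with the nonnegative
    -- functions `extSum - a * ext` and `(a + B) * ext - extSum`.
    refine ⟨-T + a + γ * (y - a), fun w hw _ => ?_⟩
    have hsplit := extSum_add (L := L) (S := S) r N w
    rw [Finset.sum_add_distrib] at hsplit
    have hinc : |∑ c ∈ words A N, ext L S r (c ++ w) * (S (c ++ w) - S w)| ≤
        T * ext L S (r + N) w := by
      refine (Finset.abs_sum_le_sum_abs _ _).trans ?_
      rw [ext_add, Finset.mul_sum]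
      refine Finset.sum_le_sum fun c hc => ?_
      rw [mem_words] at hc
      rw [abs_mul, abs_of_nonneg (ext_nonneg _ _), mul_comm, hT, ← hc]
      gcongr
      · exact ext_nonneg _ _
      · exact hS.abs_increment_le c w
    have hinc' := _root_.abs_le.1 hinc
    have m1 := minorization hS hL hv hm r (-a) 1
      (fun w hw hk => by have := (ha w hw hk).1; linarith) w
    have m2 := minorization hS hL hv hm r (a + B) (-1)
      (fun w hw hk => by have := (ha w hw hk).2; linarith) w
    rw [Finset.sum_add_distrib, ← Finset.mul_sum, ← Finset.mul_sum, ← ext_add] at m1 m2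
    have hb := hbound w
    have hE0 := ext_nonneg (L := L) (S := S) (r + N) w
    rw [← hE, ← hY, hYE] at m1 m2
    constructor
    · have h1 : (y - a) * (γ * ext L S (r + N) w) ≤
          (y - a) * (Real.exp (-(2 * D + F * l)) * wt L S w * E) :=
        mul_le_mul_of_nonneg_left hb (by linarith)
      linarith
    · have h1 : (a + B - y) * (γ * ext L S (r + N) w) ≤
          (a + B - y) * (Real.exp (-(2 * D + F * l)) * wt L S w * E) :=
        mul_le_mul_of_nonneg_left hb (by linarith)
      have h2 : 2 * T * ext L S (r + N) w ≤ γ * B * ext L S (r + N) w := by gcongr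
      linarith

lemma ext_pos (hS : AlmostAdditive D F S) (hL : IsGluing L l) {w : List A} (hw : w ∈ L) (n : ℕ) :
    0 < ext L S n w := by
  obtain ⟨c, hc, h⟩ := exists_le_ext hL D F
  refine lt_of_lt_of_le ?_ (h S hS n w)
  have := part_pos (S := S) hL n
  rw [wt_of_mem hw]
  positivity

/-- Exponential moments of the increments, by the martingale argument of Azuma and Hoeffding. -/
lemma sum_exp_le (hS : AlmostAdditive D F S) (hL : IsGluing L l) {k : ℕ} {B ε : ℝ}
    (hB : ∀ n, ∃ a, ∀ w ∈ L, k ≤ w.length → a * ext L S n w ≤ extSum L S n w ∧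
        extSum L S n w ≤ (a + B) * ext L S n w)
    (hε : |ε| * (B + 2 * (D + F)) ≤ 1) (n : ℕ) :
    ∀ w ∈ L, k ≤ w.length → ∑ b ∈ words A n, wt L S (b ++ w) * Real.exp (ε * (S (b ++ w) - S w)) ≤
      ext L S n w * Real.exp (ε * (extSum L S n w / ext L S n w) +
        n * (ε * (B + 2 * (D + F))) ^ 2) := by
  set R := B + 2 * (D + F) with hR
  induction n with
  | zero =>
    intro w hw _
    simp [words_zero, ext, extSum]
  | succ n ih =>
    intro w hw hk
    obtain ⟨a, ha⟩ := hB n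
    set E := ext L S (n + 1) w with hE
    have hEp : 0 < E := ext_pos hS hL hw _
    set y := extSum L S (n + 1) w / E with hy
    -- The Doob martingale: `ξ c` is the conditional mean of the total increment once the letter `c`
    -- is revealed, and its weighted average is `y`.
    set ξ : List A → ℝ := fun c => S (c ++ w) - S w + extSum L S n (c ++ w) / ext L S n (c ++ w)
      with hξ
    have hEs : E = ∑ c ∈ words A 1, ext L S n (c ++ w) := ext_add _ _ _
    have hMs : extSum L S (n + 1) w = ∑ c ∈ words A 1, ext L S n (c ++ w) * ξ c := by
      rw [extSum_add]
      refine Finset.sum_congr rfl fun c _ => ?_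
      by_cases hc : c ++ w ∈ L
      · have := (ext_pos hS hL hc n).ne'
        simp only [hξ]; field_simp; ring
      · simp [ext_of_notMem hL hc, extSum_of_notMem hL hc]
    have hξb : ∀ c ∈ words A 1, c ++ w ∈ L → a - (D + F) ≤ ξ c ∧ ξ c ≤ a + B + (D + F) := by
      intro c hc hcw
      rw [mem_words] at hc
      have hp := ext_pos hS hL hcw n
      have h1 := ha _ hcw (by simp; omega)
      have h2 := _root_.abs_le.1 (hS.abs_increment_le c w)
      rw [hc] at h2
      rw [← le_div_iff₀ hp, ← div_le_iff₀ hp] at h1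
      simp only [hξ]
      push_cast at h2
      constructor <;> linarith [h1.1, h1.2, h2.1, h2.2]
    have hy1 : a - (D + F) ≤ y := by
      rw [hy, le_div_iff₀ hEp, hMs, hEs, Finset.mul_sum]
      refine Finset.sum_le_sum fun c hc => ?_
      by_cases hcw : c ++ w ∈ L
      · rw [mul_comm]
        exact mul_le_mul_of_nonneg_left (hξb c hc hcw).1 (ext_nonneg _ _)
      · simp [ext_of_notMem hL hcw]
    have hy2 : y ≤ a + B + (D + F) := by
      rw [hy, div_le_iff₀ hEp, hMs, hEs, Finset.mul_sum]
      refine Finset.sum_le_sum fun c hc => ?_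
      by_cases hcw : c ++ w ∈ L
      · rw [mul_comm]
        exact mul_le_mul_of_nonneg_right (hξb c hc hcw).2 (ext_nonneg _ _)
      · simp [ext_of_notMem hL hcw]
    -- Uses `exp x ≤ 1 + x + x ^ 2` for `|x| ≤ 1`; the linear term vanishes after summation over
    -- `c`.
    have step : ∀ c ∈ words A 1, ext L S n (c ++ w) * Real.exp (ε * ξ c) ≤
        Real.exp (ε * y) * (ext L S n (c ++ w) * (1 + (ε * R) ^ 2) +
          ε * (ext L S n (c ++ w) * ξ c - ext L S n (c ++ w) * y)) := by
      intro c hc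
      by_cases hcw : c ++ w ∈ L
      swap
      · simp [ext_of_notMem hL hcw]
      obtain ⟨h1, h2⟩ := hξb c hc hcw
      have h3 : |ξ c - y| ≤ R := by
        rw [hR, _root_.abs_le]; constructor <;> linarith
      have h4 : |ε * (ξ c - y)| ≤ |ε| * R := by rw [abs_mul]; gcongr
      have h5 := (_root_.abs_le.1 (Real.abs_exp_sub_one_sub_id_le (h4.trans hε))).2
      have h6 : (ε * (ξ c - y)) ^ 2 ≤ (ε * R) ^ 2 := by
        rw [mul_pow, mul_pow]
        gcongr 1
        rw [← sq_abs (ξ c - y)]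
        gcongr
      have h7 : Real.exp (ε * ξ c) = Real.exp (ε * y) * Real.exp (ε * (ξ c - y)) := by
        rw [← Real.exp_add]; congr 1; ring
      rw [h7]
      have h8 : Real.exp (ε * (ξ c - y)) ≤ 1 + (ε * R) ^ 2 + ε * (ξ c - y) := by linarith
      have h9 := ext_nonneg (L := L) (S := S) n (c ++ w)
      calc _ ≤ ext L S n (c ++ w) * (Real.exp (ε * y) * (1 + (ε * R) ^ 2 + ε * (ξ c - y))) := by
            gcongr
        _ = _ := by ring
    have hsumstep : ∑ c ∈ words A 1, ext L S n (c ++ w) * Real.exp (ε * ξ c) ≤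
        Real.exp (ε * y) * (E * (1 + (ε * R) ^ 2)) := by
      refine (Finset.sum_le_sum step).trans (le_of_eq ?_)
      rw [← Finset.mul_sum, Finset.sum_add_distrib, ← Finset.sum_mul, ← Finset.mul_sum,
        Finset.sum_sub_distrib, ← Finset.sum_mul, ← hEs, ← hMs, hy]
      field_simp
      ring
    calc ∑ b ∈ words A (n + 1), wt L S (b ++ w) * Real.exp (ε * (S (b ++ w) - S w))
        = ∑ c ∈ words A 1, Real.exp (ε * (S (c ++ w) - S w)) *
            ∑ b ∈ words A n, wt L S (b ++ (c ++ w)) *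
              Real.exp (ε * (S (b ++ (c ++ w)) - S (c ++ w))) := by
          rw [sum_words_add, Finset.sum_comm]
          refine Finset.sum_congr rfl fun c _ => ?_
          rw [Finset.mul_sum]
          refine Finset.sum_congr rfl fun b _ => ?_
          rw [List.append_assoc, mul_left_comm, ← Real.exp_add]
          congr 2; ring
      _ ≤ ∑ c ∈ words A 1, Real.exp (n * (ε * R) ^ 2) *
            (ext L S n (c ++ w) * Real.exp (ε * ξ c)) := by
          refine Finset.sum_le_sum fun c _ => ?_
          by_cases hcw : c ++ w ∈ L
          · calc _ ≤ Real.exp (ε * (S (c ++ w) - S w)) * _ :=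
                  mul_le_mul_of_nonneg_left (ih _ hcw (by simp; omega)) (Real.exp_pos _).le
              _ = _ := by
                  rw [mul_left_comm, ← Real.exp_add, mul_left_comm, ← Real.exp_add]
                  congr 2; simp only [hξ]; ring
          · simp [ext_of_notMem hL hcw, hL.wt_append_eq_zero hcw]
      _ ≤ Real.exp (n * (ε * R) ^ 2) * (Real.exp (ε * y) * (E * (1 + (ε * R) ^ 2))) := by
          rw [← Finset.mul_sum]
          gcongr
      _ ≤ Real.exp (n * (ε * R) ^ 2) * (Real.exp (ε * y) * (E * Real.exp ((ε * R) ^ 2))) := by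
          gcongr
          rw [add_comm]; exact Real.add_one_le_exp _
      _ = _ := by
          rw [show Real.exp (n * (ε * R) ^ 2) * (Real.exp (ε * y) * (E * Real.exp ((ε * R) ^ 2))) =
            E * (Real.exp (ε * y) * (Real.exp (n * (ε * R) ^ 2) * Real.exp ((ε * R) ^ 2))) by ring,
            ← Real.exp_add, ← Real.exp_add]
          push_cast
          congr 2; ring

/-- The centre `a` is chosen before `ε`, so that it serves both `ε` and `-ε`. The summand `1` in the
exponent pays for `S` on the `k` base letters and for the deviation of the conditional means from
`a`. -/
lemma exists_part_perturb_le (hL : IsGluing L l) {v : List A} (hv : IsSync L v) (D F : ℝ) :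
    ∃ β > 0, ∀ k : ℕ, 0 < k → ∀ S, AlmostAdditive D F S → HasMemory k S → ∀ n, ∃ a, ∀ ε : ℝ,
      |ε| * (β * k) ≤ 1 → part L (fun w => (1 + ε) * S w) (n + k) ≤
        Real.exp (ε * a + n * (ε * (β * k)) ^ 2 + 1) * part L S (n + k) := by
  obtain ⟨β, hβ, hosc⟩ := exists_osc_bound hL hv D F
  set β' := β + 2 * (|D| + |F|)
  refine ⟨β', by positivity, fun k hk S hS hm n => ?_⟩
  obtain ⟨a, ha⟩ := hosc k hk S hS hm n
  refine ⟨a, fun ε hε => ?_⟩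
  have hD := hS.D_nonneg
  have hF := hS.F_nonneg hL
  have hk1 : (1 : ℝ) ≤ k := by exact_mod_cast hk
  have hB' : β * k + 2 * (D + F) ≤ β' * k := by
    have : 2 * (D + F) ≤ 2 * (D + F) * k := le_mul_of_one_le_right (by positivity) hk1
    simp only [β', abs_of_nonneg hD, abs_of_nonneg hF]
    linarith
  have hFB : F * k + β * k ≤ β' * k := by
    simp only [β', abs_of_nonneg hD, abs_of_nonneg hF]
    nlinarith
  have hexp := sum_exp_le hS hL (ε := ε) (hosc k hk S hS hm) (le_trans (by gcongr) hε) n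
  have hpart : part L S (n + k) = ∑ w ∈ words A k, ext L S n w := by
    rw [part, sum_words_add, Finset.sum_comm]; rfl
  rw [hpart, Finset.mul_sum, part, sum_words_add, Finset.sum_comm]
  refine Finset.sum_le_sum fun w hw => ?_
  rw [mem_words] at hw
  by_cases hwL : w ∈ L
  swap
  · rw [ext_of_notMem hL hwL, mul_zero]
    exact (Finset.sum_eq_zero fun b _ => hL.wt_append_eq_zero hwL b).le
  have hp := ext_pos hS hL hwL n
  obtain ⟨h1, h2⟩ := ha w hwL hw.ge
  rw [← le_div_iff₀ hp] at h1
  rw [← div_le_iff₀ hp] at h2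
  have e : ∑ b ∈ words A n, wt L (fun w => (1 + ε) * S w) (b ++ w) = Real.exp (ε * S w) *
      ∑ b ∈ words A n, wt L S (b ++ w) * Real.exp (ε * (S (b ++ w) - S w)) := by
    rw [Finset.mul_sum]
    refine Finset.sum_congr rfl fun b _ => ?_
    by_cases hb : b ++ w ∈ L
    · rw [wt_of_mem hb, wt_of_mem hb, ← Real.exp_add, ← Real.exp_add]
      congr 1; ring
    · rw [wt_of_notMem hb, wt_of_notMem hb, zero_mul, mul_zero]
  rw [e]
  refine (mul_le_mul_of_nonneg_left (hexp w hwL hw.ge) (Real.exp_pos _).le).trans ?_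
  rw [mul_left_comm, mul_comm (Real.exp _) (ext L S n w), ← Real.exp_add]
  refine mul_le_mul_of_nonneg_left (Real.exp_le_exp.2 ?_) (ext_nonneg _ _)
  set y := extSum L S n w / ext L S n w
  have i1 : ε * S w ≤ |ε| * (F * k) := by
    refine (le_abs_self _).trans ?_
    rw [abs_mul, ← hw]
    gcongr
    exact hS.abs_le w
  have i2 : ε * (y - a) ≤ |ε| * (β * k) := by
    refine (le_abs_self _).trans ?_
    rw [abs_mul]
    gcongr
    rw [_root_.abs_le]
    have : 0 ≤ β * k := by positivity
    constructor <;> linarith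
  have i3 : (ε * (β * k + 2 * (D + F))) ^ 2 ≤ (ε * (β' * k)) ^ 2 := by
    rw [mul_pow, mul_pow ε]
    gcongr
  have i4 : |ε| * (F * k + β * k) ≤ 1 := le_trans (by gcongr) hε
  have i5 : (n : ℝ) * (ε * (β * k + 2 * (D + F))) ^ 2 ≤ n * (ε * (β' * k)) ^ 2 := by gcongr
  linarith

/-- The pressure of a potential with finite memory has bounded second differences. -/
lemma exists_pressure_second_difference_le (hL : IsGluing L l) {v : List A} (hv : IsSync L v)
    (D F : ℝ) :
    ∃ β > 0, ∀ k : ℕ, 0 < k → ∀ S, AlmostAdditive D F S → HasMemory k S →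
      ∀ ε K P P₁ P₂ : ℝ,
      |ε| * (β * k) ≤ 1 → 0 < K → HasRate (part L S) K P →
      HasRate (part L fun w => (1 + ε) * S w) K P₁ →
      HasRate (part L fun w => (1 + -ε) * S w) K P₂ →
      P₁ + P₂ - 2 * P ≤ 2 * (ε * (β * k)) ^ 2 := by
  obtain ⟨β, hβ, h⟩ := exists_part_perturb_le hL hv D F
  refine ⟨β, hβ, fun k hk S hS hm ε K P P₁ P₂ hε hK hP hP₁ hP₂ => ?_⟩
  suffices P₁ + P₂ ≤ 2 * P + 2 * (ε * (β * k)) ^ 2 by linarith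
  refine rate_le_of_forall (c := K⁻¹ * K⁻¹ * Real.exp (k * (P₁ + P₂)))
    (K := Real.exp 2 * (K * K * Real.exp (k * (2 * P)))) (by positivity) fun n => ?_
  obtain ⟨a, ha⟩ := h k hk S hS hm n
  have h1 := ha ε hε
  have h2 := ha (-ε) (by rwa [abs_neg])
  have l1 := (hP₁ (n + k)).1
  have l2 := (hP₂ (n + k)).1
  have u := (hP (n + k)).2
  have hp : 0 < part L S (n + k) := part_pos hL _
  set Q := (ε * (β * k)) ^ 2 with hQ
  have hQ' : (-ε * (β * k)) ^ 2 = Q := by rw [hQ]; ring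
  rw [hQ'] at h2
  -- In the product the linear terms `ε * a` and `-ε * a` cancel.
  have m := mul_le_mul (l1.trans h1) (l2.trans h2) (by positivity) (by positivity)
  calc _ = K⁻¹ * Real.exp ((n + k : ℕ) * P₁) * (K⁻¹ * Real.exp ((n + k : ℕ) * P₂)) := by
        rw [show K⁻¹ * Real.exp ((n + k : ℕ) * P₁) * (K⁻¹ * Real.exp ((n + k : ℕ) * P₂)) =
          K⁻¹ * K⁻¹ * (Real.exp ((n + k : ℕ) * P₁) * Real.exp ((n + k : ℕ) * P₂)) by ring,
          mul_assoc, ← Real.exp_add, ← Real.exp_add]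
        push_cast
        congr 2; ring
    _ ≤ _ := m
    _ = Real.exp (2 + n * (2 * Q)) * (part L S (n + k) * part L S (n + k)) := by
        rw [mul_mul_mul_comm, ← Real.exp_add]
        congr 2; ring
    _ ≤ Real.exp (2 + n * (2 * Q)) * ((K * Real.exp ((n + k : ℕ) * P)) *
          (K * Real.exp ((n + k : ℕ) * P))) := by gcongr
    _ = _ := by
        rw [mul_mul_mul_comm, ← Real.exp_add, mul_left_comm, ← Real.exp_add,
          show Real.exp 2 * (K * K * Real.exp (k * (2 * P))) *
            Real.exp (n * (2 * P + 2 * Q)) = K * K * (Real.exp 2 * Real.exp (k * (2 * P)) *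
            Real.exp (n * (2 * P + 2 * Q))) by ring, ← Real.exp_add, ← Real.exp_add]
        push_cast
        congr 2; ring

end SecondOrder

/-! ### From sequences to words: the language of a subshift. -/

section Sequences

variable {A : Type*}

/-- The word formed by the first `n` letters of a sequence. -/
def pre : ℕ → (ℕ → A) → List A
  | 0, _ => []
  | n + 1, x => x 0 :: pre n (shift x)

/-- The concatenation of a word and a sequence. -/
def ap : List A → (ℕ → A) → ℕ → A
  | [], z => z
  | a :: w, z => fun i => Nat.casesOn i a (ap w z)

lemma iterate_shift_apply (n : ℕ) (x : ℕ → A) (i : ℕ) : shift^[n] x i = x (n + i) := by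
  induction n generalizing x with
  | zero => simp
  | succ n ih => rw [Function.iterate_succ_apply, ih, shift]; congr 1; omega

@[simp] lemma length_pre (n : ℕ) (x : ℕ → A) : (pre n x).length = n := by
  induction n generalizing x with
  | zero => rfl
  | succ n ih => simp [pre, ih]

lemma pre_add (n p : ℕ) (x : ℕ → A) : pre (n + p) x = pre n x ++ pre p (shift^[n] x) := by
  induction n generalizing x with
  | zero => simp [pre]
  | succ n ih => rw [Nat.succ_add, pre, pre, ih]; rfl

@[simp] lemma shift_ap_cons (a : A) (w : List A) (z : ℕ → A) : shift (ap (a :: w) z) = ap w z := rfl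

@[simp] lemma iterate_shift_ap (w : List A) (z : ℕ → A) : shift^[w.length] (ap w z) = z := by
  induction w with
  | nil => rfl
  | cons a w ih => rw [List.length_cons, Function.iterate_succ_apply, shift_ap_cons, ih]

@[simp] lemma pre_ap (w : List A) (z : ℕ → A) : pre w.length (ap w z) = w := by
  induction w with
  | nil => rfl
  | cons a w ih => rw [List.length_cons, pre, shift_ap_cons, ih]; rfl

lemma pre_eq_pre_iff {n : ℕ} {x y : ℕ → A} : pre n x = pre n y ↔ ∀ i < n, x i = y i := by
  induction n generalizing x y with
  | zero => simp [pre]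
  | succ n ih =>
    rw [pre, pre, List.cons.injEq, ih, Nat.forall_lt_succ_left]
    rfl

lemma word_eq_word_iff {n j j' : ℕ} {x y : ℕ → A} :
    word x j n = word y j' n ↔ pre (n + 1) (shift^[j] x) = pre (n + 1) (shift^[j'] y) := by
  rw [pre_eq_pre_iff]
  simp only [iterate_shift_apply]
  constructor
  · intro h i hi
    exact congrFun h ⟨i, hi⟩
  · intro h
    ext ⟨i, hi⟩
    exact h i hi

lemma take_pre {j n : ℕ} (h : j ≤ n) (x : ℕ → A) : (pre n x).take j = pre j x := by
  obtain ⟨p, rfl⟩ := Nat.exists_eq_add_of_le h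
  rw [pre_add, List.take_left' (length_pre j x)]

lemma ofFn_eq_pre (n : ℕ) (x : ℕ → A) : List.ofFn (fun i : Fin n => x i) = pre n x := by
  induction n generalizing x with
  | zero => simp [pre]
  | succ n ih => rw [List.ofFn_succ, pre, ← ih]; rfl

lemma ofFn_word (n : ℕ) (x : ℕ → A) : List.ofFn (word x 0 n) = pre (n + 1) x := by
  rw [← ofFn_eq_pre]
  simp [word]

/-- The words that are prefixes of points of `X`. -/
def lang (X : Set (ℕ → A)) : Set (List A) := {w | ∃ x ∈ X, pre w.length x = w}

lemma pre_mem_lang {X : Set (ℕ → A)} {x : ℕ → A} (hx : x ∈ X) (n : ℕ) : pre n x ∈ lang X :=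
  ⟨x, hx, by rw [length_pre]⟩

lemma ofFn_mem_lang_iff {X : Set (ℕ → A)} {n : ℕ} {w : Fin (n + 1) → A} :
    List.ofFn w ∈ lang X ↔ w ∈ admissible X n := by
  constructor
  · rintro ⟨x, hx, h⟩
    refine ⟨x, hx, List.ofFn_injective ?_⟩
    rw [ofFn_word, ← h, List.length_ofFn]
  · rintro ⟨x, hx, rfl⟩
    rw [ofFn_word]
    exact pre_mem_lang hx _

lemma iterate_mem {X : Set (ℕ → A)} (h : MapsTo shift X X) {x : ℕ → A} (hx : x ∈ X) (n : ℕ) :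
    shift^[n] x ∈ X := h.iterate n hx

lemma lang_left {X : Set (ℕ → A)} {a b : List A} (h : a ++ b ∈ lang X) : a ∈ lang X := by
  obtain ⟨x, hx, h⟩ := h
  rw [List.length_append, pre_add] at h
  exact ⟨x, hx, (List.append_inj h (by simp)).1⟩

lemma lang_right {X : Set (ℕ → A)} (hX : MapsTo shift X X) {a b : List A} (h : a ++ b ∈ lang X) :
    b ∈ lang X := by
  obtain ⟨x, hx, h⟩ := h
  rw [List.length_append, pre_add] at h
  exact ⟨_, iterate_mem hX hx _, (List.append_inj h (by simp)).2⟩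

/-- Specification concerns nonempty words only. An empty word is replaced by a one-letter word `e`,
which is removed again after gluing. -/
lemma isGluing_lang {X : Set (ℕ → A)} (hne : X.Nonempty) (hX : MapsTo shift X X)
    (hs : IsSpecified X) : ∃ l, IsGluing (lang X) l := by
  obtain ⟨l, hl⟩ := hs
  have len : ∀ n, ∃ w ∈ lang X, w.length = n := fun n =>
    ⟨pre n hne.some, pre_mem_lang hne.some_mem n, length_pre _ _⟩
  have glue : ∀ a ∈ lang X, ∀ b ∈ lang X, a ≠ [] → b ≠ [] →
      ∃ g, g.length = l ∧ a ++ (g ++ b) ∈ lang X := by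
    rintro a ⟨x, hx, ha⟩ b ⟨y, hy, hb⟩ ha0 hb0
    obtain ⟨m, hm⟩ := Nat.exists_eq_succ_of_ne_zero (List.length_pos_iff.2 ha0).ne'
    obtain ⟨n, hn⟩ := Nat.exists_eq_succ_of_ne_zero (List.length_pos_iff.2 hb0).ne'
    obtain ⟨c, hc, -, h1, h2⟩ := hl m n _ ⟨x, hx, rfl⟩ _ ⟨y, hy, rfl⟩ l l le_rfl le_rfl
    rw [word_eq_word_iff] at h1 h2
    simp only [Function.iterate_zero, id] at h1 h2
    rw [hm] at ha
    rw [hn] at hb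
    refine ⟨pre l (shift^[m + 1] c), length_pre _ _, ?_⟩
    rw [← hb, ← h2, ← ha, ← h1, show m + l + 1 = l + (m + 1) by ring,
      Function.iterate_add_apply _ l (m + 1), ← pre_add, ← pre_add]
    exact pre_mem_lang hc _
  obtain ⟨e, he, he1⟩ := len 1
  have he0 : e ≠ [] := by rintro rfl; simp at he1
  refine ⟨l, lang_left, lang_right hX, len, fun {a b} ha hb => ?_⟩
  rcases eq_or_ne a [] with rfl | ha0 <;> rcases eq_or_ne b [] with rfl | hb0
  · obtain ⟨w, hw, hl⟩ := len l
    exact ⟨w, hl, by simpa using hw⟩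
  · obtain ⟨g, hg, h⟩ := glue e he b hb he0 hb0
    exact ⟨g, hg, lang_right hX h⟩
  · obtain ⟨g, hg, h⟩ := glue a ha e he ha0 he0
    exact ⟨g, hg, lang_left (b := e) (by simpa using h)⟩
  · exact glue a ha b hb ha0 hb0

lemma pre_infix {u : List A} {n : ℕ} {x : ℕ → A} (h : u <:+: pre n x) :
    ∃ i, u = pre u.length (shift^[i] x) := by
  obtain ⟨s, t, h⟩ := h
  have hn : n = s.length + u.length + t.length := by
    have := congrArg List.length h
    simp only [List.length_append, length_pre] at this
    omega
  rw [hn, pre_add, pre_add] at h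
  have h1 := (List.append_inj h (by simp)).1
  exact ⟨s.length, (List.append_inj h1 (by simp)).2⟩

/-- This inclusion suffices, as `localLang` serves only for upper bounds; lower bounds on `X_m` come
from `X` itself. -/
lemma lang_ftApprox_subset (X : Set (ℕ → A)) (m : ℕ) :
    lang (ftApprox X m) ⊆ localLang (lang X) m := by
  rintro w ⟨x, hx, hw⟩ u hu hum
  rw [← hw] at hu
  obtain ⟨i, hi⟩ := pre_infix hu
  rw [hi]
  obtain ⟨y, hy, h⟩ := hx i
  have h' : word y 0 m = word x i m := h
  rw [word_eq_word_iff] at h'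
  rw [← take_pre hum, ← h', take_pre hum]
  exact pre_mem_lang hy _

lemma subset_ftApprox {X : Set (ℕ → A)} (hX : MapsTo shift X X) (m : ℕ) : X ⊆ ftApprox X m := by
  intro x hx j
  refine ⟨shift^[j] x, iterate_mem hX hx j, ?_⟩
  rw [word_eq_word_iff]; rfl

end Sequences

/-! ### Follower sets of sofic shifts. -/

section Sofic

variable {A : Type*} [TopologicalSpace A] [DiscreteTopology A]

/-- A continuous letter map on a compact set of sequences depends on finitely many letters. -/
lemma exists_window {B : Type*} [TopologicalSpace B] [DiscreteTopology B] {Y : Set (ℕ → B)}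
    (hY : IsCompact Y) {f : (ℕ → B) → (ℕ → A)} (hf : ContinuousOn f Y) :
    ∃ r, ∀ y ∈ Y, ∀ y' ∈ Y, pre r y = pre r y' → f y 0 = f y' 0 := by
  suffices ∃ r, ∀ y ∈ Y, ∀ y' ∈ Y, pre r y = pre r y' → f y 0 = f y' 0 from this
  -- The property of `s` compares points of `s` with all points of `Y`, which lets it pass to
  -- unions.
  refine hY.induction_on (p := fun s => ∃ r, ∀ y ∈ s, ∀ y' ∈ Y, pre r y = pre r y' →
    f y 0 = f y' 0) ⟨0, by simp⟩ ?_ ?_ ?_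
  · rintro s t hst ⟨r, hr⟩
    exact ⟨r, fun y hy => hr y (hst hy)⟩
  · rintro s t ⟨r, hr⟩ ⟨r', hr'⟩
    refine ⟨max r r', fun y hy y' hy' h => ?_⟩
    rcases hy with hy | hy
    · refine hr y hy y' hy' ?_
      rw [← take_pre (le_max_left r r'), h, take_pre (le_max_left r r')]
    · refine hr' y hy y' hy' ?_
      rw [← take_pre (le_max_right r r'), h, take_pre (le_max_right r r')]
  · intro y hy
    have hc : ContinuousWithinAt (fun y => f y 0) Y y :=
      (continuous_apply 0).continuousAt.comp_continuousWithinAt (hf y hy)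
    have hm : {y' | f y' 0 = f y 0} ∈ 𝓝[Y] y := hc (by simp : {f y 0} ∈ 𝓝 (f y 0))
    obtain ⟨u, hu, hu'⟩ := mem_nhdsWithin_iff_exists_mem_nhds_inter.1 hm
    obtain ⟨_, ⟨z, r, rfl⟩, hyz, hzu⟩ :=
      (PiNat.isTopologicalBasis_cylinders (fun _ : ℕ => B)).mem_nhds_iff.1 hu
    rw [PiNat.mem_cylinder_iff_eq] at hyz
    refine ⟨{y' | pre r y' = pre r y} ∩ Y, ?_, r, ?_⟩
    · refine inter_mem (mem_nhdsWithin_of_mem_nhds ?_) self_mem_nhdsWithin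
      have : PiNat.cylinder y r ⊆ {y' | pre r y' = pre r y} := fun y' h =>
        pre_eq_pre_iff.2 (PiNat.mem_cylinder_iff.1 h)
      exact mem_of_superset
        ((PiNat.isOpen_cylinder _ y r).mem_nhds (PiNat.self_mem_cylinder y r)) this
    · have key : ∀ y' ∈ Y, pre r y' = pre r y → f y' 0 = f y 0 := by
        intro y' hy' h
        refine hu' ⟨hzu ?_, hy'⟩
        rw [← hyz, PiNat.mem_cylinder_iff]
        exact pre_eq_pre_iff.1 h
      rintro y₁ ⟨h₁, hy₁⟩ y₂ hy₂ h
      rw [key y₁ hy₁ h₁, key y₂ hy₂ (h ▸ h₁)]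

lemma isClosed_sft {B : Type*} [TopologicalSpace B] [DiscreteTopology B] {n : ℕ}
    (L : Set (Fin (n + 1) → B)) : IsClosed (sft L) := by
  have : sft L = ⋂ j, (fun x => word x j n) ⁻¹' L := by
    ext x; simp [sft]
  rw [this]
  refine isClosed_iInter fun j => (isClosed_discrete L).preimage ?_
  exact continuous_pi fun i => continuous_apply _

omit [TopologicalSpace A] [DiscreteTopology A] in
lemma sft_shift {n : ℕ} {L : Set (Fin (n + 1) → A)} {y : ℕ → A} (hy : y ∈ sft L) :
    shift y ∈ sft L := by
  intro j
  have : word (shift y) j n = word y (j + 1) n := by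
    ext i; simp only [word, shift]; congr 1; omega
  rw [this]; exact hy _

-- By induction on `i` only the window at `0` is new. It lies within the first `i + 1 + R` letters,
-- where the spliced sequence still coincides with `y`.
omit [TopologicalSpace A] [DiscreteTopology A] in
lemma ap_mem_sft {n R : ℕ} {L : Set (Fin (n + 1) → A)} (hR : n ≤ R) {i : ℕ} {y z : ℕ → A}
    (hy : y ∈ sft L) (hz : z ∈ sft L) (h : pre R (shift^[i] y) = pre R z) :
    ap (pre i y) z ∈ sft L := by
  induction i generalizing y with
  | zero => exact hz
  | succ i ih =>
    have h1 := ih (sft_shift hy) h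
    intro j
    cases j with
    | succ j =>
      have h2 := h1 j
      rw [pre]
      convert h2 using 1
      rw [word_eq_word_iff, Function.iterate_succ_apply, shift_ap_cons]
    | zero =>
      have h2 := hy 0
      convert h2 using 1
      rw [word_eq_word_iff]
      have h3 : pre (i + 1 + R) (ap (pre (i + 1) y) z) = pre (i + 1 + R) y := by
        rw [pre_add (i + 1), pre_add (i + 1), h]
        have := pre_ap (pre (i + 1) y) z
        have h4 := iterate_shift_ap (pre (i + 1) y) z
        rw [length_pre] at this h4
        rw [this, h4]
      have h5 : n + 1 ≤ i + 1 + R := by omega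
      simp only [Function.iterate_zero, id]
      rw [← take_pre h5, h3, take_pre h5]

/-- A sofic shift has finitely many follower sets. -/
lemma finite_followers {X : Set (ℕ → A)} (hX : IsSofic X) :
    {F : Set (List A) | ∃ u, F = {w | u ++ w ∈ lang X}}.Finite := by
  obtain ⟨q, n, L, f, hf, hcomm, rfl⟩ := hX
  set Y := sft L
  have hY : IsCompact Y := (isClosed_sft L).isCompact
  obtain ⟨r, hr⟩ := exists_window hY hf
  have hiter : ∀ i, ∀ y ∈ Y, shift^[i] y ∈ Y ∧ f (shift^[i] y) = shift^[i] (f y) := by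
    intro i
    induction i with
    | zero => intro y hy; exact ⟨hy, rfl⟩
    | succ i ih =>
      intro y hy
      have := ih _ (sft_shift hy)
      rw [Function.iterate_succ_apply, Function.iterate_succ_apply, ← hcomm y hy]
      exact this
  set R := max r n with hR
  have hwin : ∀ i, ∀ y ∈ Y, ∀ y' ∈ Y, pre (i + R) y = pre (i + R) y' →
      pre i (f y) = pre i (f y') := by
    intro i y hy y' hy' h
    rw [pre_eq_pre_iff] at h ⊢
    intro j hj
    have := hr _ (hiter j y hy).1 _ (hiter j y' hy').1 (by
      rw [pre_eq_pre_iff]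
      intro s hs
      rw [iterate_shift_apply, iterate_shift_apply]
      refine h _ ?_
      have := le_max_left r n
      omega)
    rw [(hiter j y hy).2, (hiter j y' hy').2, iterate_shift_apply, iterate_shift_apply] at this
    exact this
  -- `St u` collects the blocks of length `R` that may follow a coding of `u`. It determines the
  -- follower set of `u`, and it is a set of words of length `R`, so there are finitely many values.
  set St : List A → Set (List (Fin q)) := fun u =>
    {s | ∃ y ∈ Y, pre u.length (f y) = u ∧ pre R (shift^[u.length] y) = s}
  have hfol : ∀ u w, u ++ w ∈ lang (f '' Y) ↔
      ∃ s ∈ St u, ∃ z ∈ Y, pre R z = s ∧ pre w.length (f z) = w := by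
    intro u w
    constructor
    · rintro ⟨_, ⟨y, hy, rfl⟩, h⟩
      rw [List.length_append, pre_add] at h
      obtain ⟨h1, h2⟩ := List.append_inj h (by simp)
      refine ⟨_, ⟨y, hy, h1, rfl⟩, _, (hiter u.length y hy).1, rfl, ?_⟩
      rw [(hiter u.length y hy).2, h2]
    · rintro ⟨_, ⟨y, hy, hu, rfl⟩, z, hz, hs, hw⟩
      have hmem : ap (pre u.length y) z ∈ Y := ap_mem_sft (le_max_right r n) hy hz hs.symm
      refine ⟨_, ⟨_, hmem, rfl⟩, ?_⟩
      have e1 := pre_ap (pre u.length y) z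
      have e2 := iterate_shift_ap (pre u.length y) z
      rw [length_pre] at e1 e2
      have e3 := (hiter u.length _ hmem).2
      rw [e2] at e3
      rw [List.length_append, pre_add, ← e3, hw]
      congr 1
      refine (hwin _ _ hmem _ hy ?_).trans hu
      rw [pre_add, pre_add, e1, e2, hs]
  have hfin : (Set.range St).Finite := by
    refine ((words (Fin q) R).finite_toSet.finite_subsets).subset ?_
    rintro _ ⟨u, rfl⟩ s ⟨y, -, -, rfl⟩
    simp
  refine (hfin.image fun T => {w | ∃ s ∈ T, ∃ z ∈ Y, pre R z = s ∧ pre w.length (f z) = w}).subset ?_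
  rintro _ ⟨u, rfl⟩
  refine ⟨St u, ⟨u, rfl⟩, ?_⟩
  ext w
  exact (hfol u w).symm

/-- A sofic shift has a synchronizing word: one with a minimal follower set. -/
lemma exists_isSync {X : Set (ℕ → A)} (hX : MapsTo shift X X) (hne : X.Nonempty)
    (hs : IsSofic X) : ∃ v, IsSync (lang X) v := by
  set Fs := {F : Set (List A) | ∃ u ∈ lang X, F = {w | u ++ w ∈ lang X}} with hFs
  have hfin : Fs.Finite := (finite_followers hs).subset fun F ⟨u, _, h⟩ => ⟨u, h⟩
  have hFne : Fs.Nonempty := ⟨_, pre 0 hne.some, pre_mem_lang hne.some_mem 0, rfl⟩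
  obtain ⟨F, hF⟩ := hfin.exists_minimal hFne
  obtain ⟨v, hv, rfl⟩ := hF.1
  refine ⟨v, hv, fun a b ha hb => ?_⟩
  -- The followers of `a ++ v` are among those of `v`; minimality gives equality, which is
  -- synchronization.
  have hsub : {w | (a ++ v) ++ w ∈ lang X} ⊆ {w | v ++ w ∈ lang X} := fun w hw => by
    have hw' : a ++ (v ++ w) ∈ lang X := by simpa using hw
    exact lang_right hX hw'
  have := hF.2 (y := {w | (a ++ v) ++ w ∈ lang X}) ⟨_, ha, rfl⟩ hsub hb
  simpa using this

end Sofic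

/-! ### Regular potentials, truncation and the pressure function. -/

section Potential

variable {A : Type*}

/-- The sum of `σ` over the nonempty suffixes of a word. -/
def suffixSum (σ : List A → ℝ) : List A → ℝ
  | [] => 0
  | a :: w => σ (a :: w) + suffixSum σ w

/-- A bounded function on words that depends exponentially little on remote letters. -/
structure IsRegular (C θ F : ℝ) (σ : List A → ℝ) : Prop where
  bound : ∀ u, |σ u| ≤ F
  holder : ∀ (j : ℕ) (u u' : List A), j + 1 ≤ u.length → j + 1 ≤ u'.length →
    u.take (j + 1) = u'.take (j + 1) → |σ u - σ u'| ≤ C * θ ^ j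

variable {σ : List A → ℝ} {C θ F : ℝ}

lemma IsRegular.C_nonneg [Nonempty A] (h : IsRegular C θ F σ) : 0 ≤ C := by
  inhabit A
  simpa using h.holder 0 [default] [default] (by simp) (by simp) rfl

/-- Appending `b` changes `σ` at the suffix of `a` of length `j + 1` by at most `C * θ ^ j`; the sum
over `j` is geometric. -/
lemma IsRegular.almostAdditive (h : IsRegular C θ F σ) (hC : 0 ≤ C) (h0 : 0 ≤ θ) (h1 : θ < 1) :
    AlmostAdditive (C / (1 - θ)) F (suffixSum σ) := by
  refine ⟨fun w => ?_, fun a b => ?_⟩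
  · induction w with
    | nil => simp [suffixSum]
    | cons a w ih =>
      rw [suffixSum, List.length_cons]
      push_cast
      have := abs_add_le (σ (a :: w)) (suffixSum σ w)
      have := h.bound (a :: w)
      linarith
  · have key : |suffixSum σ (a ++ b) - (suffixSum σ a + suffixSum σ b)| ≤
        ∑ j ∈ Finset.range a.length, C * θ ^ j := by
      induction a with
      | nil => simp [suffixSum]
      | cons x a ih =>
        rw [List.cons_append, suffixSum, suffixSum, List.length_cons, Finset.sum_range_succ]
        have h2 := h.holder a.length (x :: (a ++ b)) (x :: a) (by simp) (by simp) (by simp)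
        have h3 := abs_add_le (σ (x :: (a ++ b)) - σ (x :: a))
          (suffixSum σ (a ++ b) - (suffixSum σ a + suffixSum σ b))
        rw [show σ (x :: (a ++ b)) + suffixSum σ (a ++ b) - (σ (x :: a) + suffixSum σ a +
          suffixSum σ b) = (σ (x :: (a ++ b)) - σ (x :: a)) + (suffixSum σ (a ++ b) -
          (suffixSum σ a + suffixSum σ b)) by ring]
        linarith
    refine key.trans ?_
    rw [← Finset.mul_sum, div_eq_mul_inv]
    gcongr
    rw [← tsum_geometric_of_lt_one h0 h1]
    exact (summable_geometric_of_lt_one h0 h1).sum_le_tsum _ fun i _ => by positivity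

/-- Truncation of a function on words to the first `k + 1` letters. -/
def truncate (σ : List A → ℝ) (k : ℕ) (u : List A) : ℝ := σ (u.take (k + 1))

lemma IsRegular.truncate (h : IsRegular C θ F σ) (hC : 0 ≤ C) (h0 : 0 ≤ θ) (k : ℕ) :
    IsRegular C θ F (truncate σ k) := by
  refine ⟨fun u => h.bound _, fun j u u' hu hu' huu => ?_⟩
  unfold SoficGibbs.truncate
  rcases le_or_gt j k with hj | hj
  · refine h.holder j _ _ (by simp; omega) (by simp; omega) ?_
    rw [List.take_take, List.take_take, min_eq_left (by omega), huu]
  · have : u.take (k + 1) = u'.take (k + 1) := by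
      have := congrArg (List.take (k + 1)) huu
      rwa [List.take_take, List.take_take, min_eq_left (by omega)] at this
    rw [this, sub_self, abs_zero]
    positivity

/-- One of the `k + 1` letters read by the truncation is a prepended letter, so at most `k` belong
to the tail. -/
lemma hasMemory_truncate (σ : List A → ℝ) (k : ℕ) : HasMemory k (suffixSum (truncate σ k)) := by
  intro b w w' _ _ h
  induction b with
  | nil => simp
  | cons x b ih =>
    have : truncate σ k (x :: (b ++ w)) = truncate σ k (x :: (b ++ w')) := by
      have ht : ∀ j ≤ k, w.take j = w'.take j := fun j hj => by
        have := congrArg (List.take j) h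
        rwa [List.take_take, List.take_take, min_eq_left hj] at this
      simp only [truncate, List.take_succ_cons, List.take_append]
      rw [ht _ (by omega)]
    rw [List.cons_append, List.cons_append, suffixSum, suffixSum, this]
    linarith

lemma IsRegular.abs_sub_truncate (h : IsRegular C θ F σ) (hC : 0 ≤ C) (h0 : 0 ≤ θ) (k : ℕ)
    (w : List A) : |suffixSum σ w - suffixSum (SoficGibbs.truncate σ k) w| ≤
      w.length * (C * θ ^ k) := by
  have h1 : ∀ u, |σ u - SoficGibbs.truncate σ k u| ≤ C * θ ^ k := by
    intro u
    unfold SoficGibbs.truncate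
    rcases le_or_gt u.length (k + 1) with hu | hu
    · rw [List.take_of_length_le hu, sub_self, abs_zero]; positivity
    · exact h.holder k _ _ hu.le (by simp; omega) (by rw [List.take_take, min_self])
  induction w with
  | nil => simp [suffixSum]
  | cons a w ih =>
    rw [suffixSum, suffixSum, List.length_cons]
    push_cast
    have := abs_add_le (σ (a :: w) - SoficGibbs.truncate σ k (a :: w))
      (suffixSum σ w - suffixSum (SoficGibbs.truncate σ k) w)
    rw [show σ (a :: w) + suffixSum σ w - (SoficGibbs.truncate σ k (a :: w) +
      suffixSum (SoficGibbs.truncate σ k) w) = (σ (a :: w) - SoficGibbs.truncate σ k (a :: w)) +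
      (suffixSum σ w - suffixSum (SoficGibbs.truncate σ k) w) by ring]
    linarith [h1 (a :: w)]

lemma part_le_of_abs_sub_le [Finite A] (L : Set (List A)) {S S' : List A → ℝ} {δ : ℝ}
    (h : ∀ w, |S w - S' w| ≤ w.length * δ) (n : ℕ) :
    part L S n ≤ Real.exp (n * δ) * part L S' n := by
  rw [part, part, Finset.mul_sum]
  refine Finset.sum_le_sum fun w hw => ?_
  rw [mem_words] at hw
  by_cases hL : w ∈ L
  · rw [wt_of_mem hL, wt_of_mem hL, ← Real.exp_add]
    refine Real.exp_le_exp.2 ?_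
    have := (abs_le.1 (h w)).2
    rw [hw] at this
    linarith
  · rw [wt_of_notMem hL, wt_of_notMem hL, mul_zero]

lemma rate_le_of_abs_sub_le [Finite A] {L : Set (List A)} {S S' : List A → ℝ} {δ K K' P P' : ℝ}
    (hK : 0 < K) (h : ∀ w, |S w - S' w| ≤ w.length * δ)
    (hP : HasRate (part L S) K P) (hP' : HasRate (part L S') K' P') : P ≤ P' + δ := by
  refine rate_le_of_forall (inv_pos.2 hK) (K := K') fun n => ?_
  refine (hP n).1.trans ((part_le_of_abs_sub_le L h n).trans ?_)
  have := (hP' n).2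
  calc _ ≤ Real.exp (n * δ) * (K' * Real.exp (n * P')) := by gcongr
    _ = _ := by rw [mul_left_comm, ← Real.exp_add]; congr 2; ring

/-- The pressure function of a regular potential, its approximation along the local languages and
a bound for its second differences. -/
lemma exists_pressure_function [Fintype A] [Nonempty A] {L : Set (List A)} {l : ℕ}
    (hL : IsGluing L l) {v : List A} (hv : IsSync L v) (hσ : IsRegular C θ F σ) (h0 : 0 ≤ θ)
    (h1 : θ < 1) :
    ∃ (P : ℝ → ℝ) (K : ℝ), 0 < K ∧ ∃ ρ > 0, ρ < 1 ∧ ∃ β > 0,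
      (∀ s, |s| ≤ 2 → HasRate (part L fun w => s * suffixSum σ w) K (P s) ∧
        ∀ m n : ℕ, part (localLang L m) (fun w => s * suffixSum σ w) n ≤
          K * Real.exp (n * (P s + K * ρ ^ m))) ∧
      ∀ k : ℕ, 0 < k → ∀ ε : ℝ, |ε| ≤ 1 → |ε| * (β * k) ≤ 1 →
        P (1 + ε) + P (1 + -ε) - 2 * P 1 ≤ 2 * (ε * (β * k)) ^ 2 + 8 * (C * θ ^ k) := by
  have hC := hσ.C_nonneg
  set D := C / (1 - θ)
  have hD : 0 ≤ D := div_nonneg hC (by linarith)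
  have hF : 0 ≤ F := (abs_nonneg _).trans (hσ.bound [])
  -- The bounds `2 * D` and `2 * F` cover all multiples `s` with `|s| ≤ 2`, so the constants below
  -- are independent of `s`.
  have hAA : ∀ τ : List A → ℝ, IsRegular C θ F τ → ∀ s : ℝ, |s| ≤ 2 →
      AlmostAdditive (2 * D) (2 * F) fun w => s * suffixSum τ w := fun τ hτ s hs =>
    ((hτ.almostAdditive hC h0 h1).const_mul s).mono (by gcongr) (by gcongr)
  obtain ⟨K, hK, ρ, hρ, hρ1, hloc⟩ := exists_part_localLang_le hL hv (2 * D) (2 * F)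
  obtain ⟨K', hK', hpr⟩ := exists_pressure hL (2 * D) (2 * F)
  obtain ⟨β, hβ, hsec⟩ := exists_pressure_second_difference_le hL hv D F
  have hex : ∀ s : ℝ, ∃ P, |s| ≤ 2 → HasRate (part L fun w => s * suffixSum σ w) K P ∧
        ∀ m n : ℕ, part (localLang L m) (fun w => s * suffixSum σ w) n ≤
          K * Real.exp (n * (P + K * ρ ^ m)) := by
    intro s
    by_cases hs : |s| ≤ 2
    · obtain ⟨P, hP⟩ := hloc _ (hAA σ hσ s hs)
      exact ⟨P, fun _ => hP⟩
    · exact ⟨0, fun h => absurd h hs⟩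
  choose P hP using hex
  refine ⟨P, K, hK, ρ, hρ, hρ1, β, hβ, hP, fun k hk ε hε hεk => ?_⟩
  have hτ := hσ.truncate hC h0 k
  have b1 : |1 + ε| ≤ 2 := by
    have := abs_add_le 1 ε; rw [abs_one] at this; linarith
  have b2 : |1 + -ε| ≤ 2 := by
    have := abs_add_le 1 (-ε); rw [abs_one, abs_neg] at this; linarith
  have b3 : |(1 : ℝ)| ≤ 2 := by norm_num
  obtain ⟨P₁, hP₁⟩ := hpr _ (hAA _ hτ _ b1)
  obtain ⟨P₂, hP₂⟩ := hpr _ (hAA _ hτ _ b2)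
  obtain ⟨P₀, hP₀⟩ := hpr _ (hAA _ hτ _ b3)
  have hδ : 0 ≤ C * θ ^ k := by positivity
  have diff : ∀ s : ℝ, |s| ≤ 2 → ∀ w, |s * suffixSum σ w - s * suffixSum (truncate σ k) w| ≤
      w.length * (2 * (C * θ ^ k)) := by
    intro s hs w
    rw [← mul_sub, abs_mul]
    have := hσ.abs_sub_truncate hC h0 k w
    calc _ ≤ 2 * (w.length * (C * θ ^ k)) := by gcongr
      _ = _ := by ring
  -- Each comparison costs `2 * (C * θ ^ k)` and the one at `1` counts twice, whence the factor `8`.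
  have e1 := rate_le_of_abs_sub_le hK (diff _ b1) (hP _ b1).1 hP₁
  have e2 := rate_le_of_abs_sub_le hK (diff _ b2) (hP _ b2).1 hP₂
  have e3 := rate_le_of_abs_sub_le hK' (fun w => by rw [abs_sub_comm]; exact diff _ b3 w) hP₀
    (hP _ b3).1
  simp only [one_mul] at hP₀
  have e4 := hsec k hk _ (hτ.almostAdditive hC h0 h1) (hasMemory_truncate σ k) ε K' P₀ P₁ P₂ hεk
    hK' hP₀ hP₁ hP₂
  linarith

end Potential

/-! ### Hölder potentials as functions of words. -/

section Holder

variable {A : Type*}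

/-- Every `x` shares its first letter with a constant sequence, and there are finitely many of
these. -/
lemma exists_abs_le_of_holder [Finite A] {φ : (ℕ → A) → ℝ} {C θ : ℝ}
    (hφ : ∀ (m : ℕ) (x y : ℕ → A), word x 0 m = word y 0 m → |φ x - φ y| ≤ C * θ ^ m) :
    ∃ F, ∀ x, |φ x| ≤ F := by
  have hfin : (Set.range fun a : A => |φ fun _ => a|).Finite := Set.finite_range _
  obtain ⟨M, hM⟩ := hfin.bddAbove
  refine ⟨C + M, fun x => ?_⟩
  have h1 := hφ 0 x (fun _ => x 0) (by
    ext i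
    have : i = 0 := Fin.fin_one_eq_zero i
    subst this; rfl)
  have h2 : |φ fun _ => x 0| ≤ M := hM ⟨x 0, rfl⟩
  have h3 := abs_sub_abs_le_abs_sub (φ x) (φ fun _ => x 0)
  rw [pow_zero, mul_one] at h1
  linarith

lemma exists_isRegular [Finite A] {φ : (ℕ → A) → ℝ} {C θ : ℝ}
    (hφ : ∀ (m : ℕ) (x y : ℕ → A), word x 0 m = word y 0 m → |φ x - φ y| ≤ C * θ ^ m)
    (z : ℕ → A) : ∃ F, IsRegular C θ F fun u => φ (ap u z) := by
  obtain ⟨F, hF⟩ := exists_abs_le_of_holder hφ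
  refine ⟨F, fun u => hF _, fun j u u' hu hu' h => hφ j _ _ ?_⟩
  rw [word_eq_word_iff]
  simp only [Function.iterate_zero, id]
  rw [← take_pre hu, ← take_pre hu', pre_ap, pre_ap, h]

lemma birkhoff_succ (φ : (ℕ → A) → ℝ) (k : ℕ) (x : ℕ → A) :
    birkhoff φ (k + 1) x = φ x + birkhoff φ k (shift x) := by
  rw [birkhoff, Finset.sum_range_succ', birkhoff, add_comm]
  simp [Function.iterate_succ_apply]

/-- Birkhoff sums are, up to a bounded error, functions of the word read. -/
lemma abs_birkhoff_sub_le {φ : (ℕ → A) → ℝ} {C θ : ℝ} (hC : 0 ≤ C) (h0 : 0 ≤ θ) (h1 : θ < 1)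
    (hφ : ∀ (m : ℕ) (x y : ℕ → A), word x 0 m = word y 0 m → |φ x - φ y| ≤ C * θ ^ m)
    (z x : ℕ → A) (k : ℕ) :
    |birkhoff φ k x - suffixSum (fun u => φ (ap u z)) (pre (k + 1) x)| ≤ C / (1 - θ) := by
  have hz : ∀ k (x : ℕ → A), |φ x - φ (ap (pre (k + 1) x) z)| ≤ C * θ ^ k := by
    intro k x
    refine hφ k _ _ ?_
    rw [word_eq_word_iff]
    have := pre_ap (pre (k + 1) x) z
    rw [length_pre] at this
    simp [this]
  have key : ∀ x, |birkhoff φ k x - suffixSum (fun u => φ (ap u z)) (pre (k + 1) x)| ≤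
      ∑ j ∈ Finset.range (k + 1), C * θ ^ j := by
    induction k with
    | zero =>
      intro x
      simpa [birkhoff, pre, suffixSum] using hz 0 x
    | succ k ih =>
      intro x
      rw [birkhoff_succ, Finset.sum_range_succ]
      have e1 := hz (k + 1) x
      have e2 := ih (shift x)
      have e3 := abs_add_le (φ x - φ (ap (pre (k + 1 + 1) x) z))
        (birkhoff φ k (shift x) - suffixSum (fun u => φ (ap u z)) (pre (k + 1) (shift x)))
      have e4 : suffixSum (fun u => φ (ap u z)) (pre (k + 1 + 1) x) =
        φ (ap (pre (k + 1 + 1) x) z) + suffixSum (fun u => φ (ap u z)) (pre (k + 1) (shift x)) :=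
        rfl
      rw [e4, show φ x + birkhoff φ k (shift x) - (φ (ap (pre (k + 1 + 1) x) z) +
        suffixSum (fun u => φ (ap u z)) (pre (k + 1) (shift x))) = (φ x -
        φ (ap (pre (k + 1 + 1) x) z)) + (birkhoff φ k (shift x) -
        suffixSum (fun u => φ (ap u z)) (pre (k + 1) (shift x))) by ring]
      linarith
  refine (key x).trans ?_
  rw [← Finset.mul_sum, div_eq_mul_inv]
  gcongr
  rw [← tsum_geometric_of_lt_one h0 h1]
  exact (summable_geometric_of_lt_one h0 h1).sum_le_tsum _ fun i _ => by positivity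

end Holder

/-! ### Entropy, relative entropy and the variational inequality for Gibbs weights. -/

section Weights

variable {A : Type*} [Finite A]

/-- A family of probability weights on the words of the language `L` with the Gibbs property for
the potential `S` with pressure `P`, such that `S` has mean `n * I` up to a bounded error. -/
structure IsGibbsWeights (L : Set (List A)) (S p : List A → ℝ) (κ P I : ℝ) : Prop where
  nonneg : ∀ u, 0 ≤ p u
  sum_eq_one : ∀ n, ∑ u ∈ words A n, p u = 1
  eq_zero : ∀ u, u ∉ L → p u = 0
  pos : ∀ u ∈ L, 0 < p u
  abs_log_sub_le : ∀ u ∈ L, |Real.log (p u) - (S u - u.length * P)| ≤ κ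
  abs_sum_sub_le : ∀ n, |∑ u ∈ words A n, p u * S u - n * I| ≤ κ

variable {L : Set (List A)} {S p : List A → ℝ} {κ P I : ℝ}

lemma IsGibbsWeights.abs_sum_mul_le (h : IsGibbsWeights L S p κ P I) {n : ℕ} {f : List A → ℝ}
    {c : ℝ} (hf : ∀ u ∈ L, u.length = n → |f u| ≤ c) : |∑ u ∈ words A n, p u * f u| ≤ c := by
  refine (Finset.abs_sum_le_sum_abs _ _).trans ?_
  have : ∑ u ∈ words A n, |p u * f u| ≤ ∑ u ∈ words A n, p u * c := by
    refine Finset.sum_le_sum fun u hu => ?_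
    rw [mem_words] at hu
    by_cases huL : u ∈ L
    · rw [abs_mul, abs_of_nonneg (h.nonneg u)]
      exact mul_le_mul_of_nonneg_left (hf u huL hu) (h.nonneg u)
    · simp [h.eq_zero u huL]
  rwa [← Finset.sum_mul, h.sum_eq_one, one_mul] at this

lemma tendsto_of_abs_sub_le {u : ℕ → ℝ} {a c : ℝ} (h : ∀ n : ℕ, |u n - a| ≤ c / ((n : ℝ) + 1)) :
    Tendsto u atTop (𝓝 a) := by
  rw [tendsto_iff_norm_sub_tendsto_zero]
  refine squeeze_zero (fun n => norm_nonneg _) (fun n => h n) ?_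
  exact_mod_cast (tendsto_const_div_atTop_nhds_zero_nat c).comp (tendsto_add_atTop_nat 1)

/-- The entropy of Gibbs weights is `P - I`. -/
lemma IsGibbsWeights.tendsto_entropy (h : IsGibbsWeights L S p κ P I) :
    Tendsto (fun n : ℕ => -(1 / ((n : ℝ) + 1)) *
      ∑ u ∈ words A (n + 1), p u * Real.log (p u)) atTop (𝓝 (P - I)) := by
  refine tendsto_of_abs_sub_le (c := κ + κ) fun n => ?_
  have h1 := h.abs_sum_mul_le (n := n + 1)
    (f := fun u => Real.log (p u) - (S u - u.length * P)) fun u hu _ => h.abs_log_sub_le u hu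
  have h2 := h.abs_sum_sub_le (n + 1)
  have e : ∑ u ∈ words A (n + 1), p u * (Real.log (p u) - (S u - u.length * P)) =
      ∑ u ∈ words A (n + 1), p u * Real.log (p u) - ∑ u ∈ words A (n + 1), p u * S u +
        ((n : ℝ) + 1) * P := by
    have e0 : ((n : ℝ) + 1) * P = ∑ u ∈ words A (n + 1), p u * (((n : ℝ) + 1) * P) := by
      rw [← Finset.sum_mul, h.sum_eq_one, one_mul]
    rw [e0, ← Finset.sum_sub_distrib, ← Finset.sum_add_distrib]
    refine Finset.sum_congr rfl fun u hu => ?_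
    rw [mem_words] at hu
    rw [hu]; push_cast; ring
  rw [e] at h1
  push_cast at h2
  have hn : (0 : ℝ) < n + 1 := by positivity
  set a := ∑ u ∈ words A (n + 1), p u * Real.log (p u)
  set b := ∑ u ∈ words A (n + 1), p u * S u
  rw [show -(1 / ((n : ℝ) + 1)) * a - (P - I) =
    (-(a - b + ((n : ℝ) + 1) * P) - (b - ((n : ℝ) + 1) * I)) / (n + 1) by field_simp; ring,
    abs_div, abs_of_pos hn]
  gcongr
  refine (abs_sub _ _).trans ?_
  rw [abs_neg]
  exact add_le_add h1 h2

open scoped Classical in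
/-- The relative entropy of Gibbs weights is the difference of the pressures. -/
lemma IsGibbsWeights.tendsto_relEntropy (h : IsGibbsWeights L S p κ P I) {L' : Set (List A)}
    {q : List A → ℝ} {κ' P' I' : ℝ} (h' : IsGibbsWeights L' S q κ' P' I') (hL : L ⊆ L') :
    Tendsto (fun n : ℕ => 1 / ((n : ℝ) + 1) *
      ∑ u ∈ words A (n + 1) with u ∈ L', p u * Real.log (p u / q u)) atTop (𝓝 (P' - P)) := by
  refine tendsto_of_abs_sub_le (c := κ + κ') fun n => ?_
  have e1 : ∑ u ∈ words A (n + 1) with u ∈ L', p u * Real.log (p u / q u) =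
      ∑ u ∈ words A (n + 1), p u * Real.log (p u / q u) := by
    refine Finset.sum_filter_of_ne fun u _ hu => ?_
    by_contra hu'
    exact hu (by rw [h.eq_zero u fun hL' => hu' (hL hL'), zero_mul])
  -- The potential `S` cancels in the logarithm of the quotient, leaving only the two pressures.
  have h1 := h.abs_sum_mul_le (n := n + 1) (c := κ + κ')
    (f := fun u => Real.log (p u / q u) - u.length * (P' - P)) fun u hu _ => by
      rw [Real.log_div (h.pos u hu).ne' (h'.pos u (hL hu)).ne']
      have i1 := h.abs_log_sub_le u hu
      have i2 := h'.abs_log_sub_le u (hL hu)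
      rw [abs_le] at *
      constructor <;> linarith
  have e : ∑ u ∈ words A (n + 1), p u * (Real.log (p u / q u) - u.length * (P' - P)) =
      ∑ u ∈ words A (n + 1), p u * Real.log (p u / q u) - ((n : ℝ) + 1) * (P' - P) := by
    have e0 : ((n : ℝ) + 1) * (P' - P) =
        ∑ u ∈ words A (n + 1), p u * (((n : ℝ) + 1) * (P' - P)) := by
      rw [← Finset.sum_mul, h.sum_eq_one, one_mul]
    rw [e0, ← Finset.sum_sub_distrib]
    refine Finset.sum_congr rfl fun u hu => ?_
    rw [mem_words] at hu
    rw [hu]; push_cast; ring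
  have hn : (0 : ℝ) < n + 1 := by positivity
  rw [e] at h1
  rw [e1]
  set a := ∑ u ∈ words A (n + 1), p u * Real.log (p u / q u)
  rw [show 1 / ((n : ℝ) + 1) * a - (P' - P) = (a - ((n : ℝ) + 1) * (P' - P)) / (n + 1) by
    field_simp, abs_div, abs_of_pos hn]
  gcongr

/-- The variational inequality: the pressure of `s * S` is at least the value at Gibbs weights. -/
lemma IsGibbsWeights.le_rate (h : IsGibbsWeights L S p κ P I) {L' : Set (List A)} (hL : L ⊆ L')
    {s K Q : ℝ} (hQ : ∀ n : ℕ, part L' (fun w => s * S w) n ≤ K * Real.exp (n * Q)) :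
    P + (s - 1) * I ≤ Q := by
  refine rate_le_of_forall (c := Real.exp (-(|s - 1| * κ))) (K := Real.exp κ * K)
    (Real.exp_pos _) fun n => ?_
  -- Jensen's inequality for the weights `p`; since `p u` is comparable to `exp (S u - n P)`, the
  -- convex side is comparable to `exp (-n P)` times a partition function of `s * S`.
  have j := convexOn_exp.map_sum_le (t := words A n) (w := p) (p := fun u => (s - 1) * S u)
    (fun u _ => h.nonneg u) (h.sum_eq_one n) (fun u _ => Set.mem_univ _)
  simp only [smul_eq_mul] at j
  have h1 : ∑ u ∈ words A n, p u * Real.exp ((s - 1) * S u) ≤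
      Real.exp (κ - n * P) * part L' (fun w => s * S w) n := by
    rw [part, Finset.mul_sum]
    refine Finset.sum_le_sum fun u hu => ?_
    rw [mem_words] at hu
    by_cases huL : u ∈ L
    · rw [wt_of_mem (hL huL), ← Real.exp_log (h.pos u huL), ← Real.exp_add, ← Real.exp_add]
      refine Real.exp_le_exp.2 ?_
      have := (abs_le.1 (h.abs_log_sub_le u huL)).2
      rw [hu] at this
      linarith
    · rw [h.eq_zero u huL, zero_mul]
      exact mul_nonneg (Real.exp_pos _).le (wt_nonneg _)
  have h2 : -(|s - 1| * κ) + (s - 1) * (n * I) ≤ ∑ u ∈ words A n, p u * ((s - 1) * S u) := by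
    have e : ∑ u ∈ words A n, p u * ((s - 1) * S u) = (s - 1) * ∑ u ∈ words A n, p u * S u := by
      rw [Finset.mul_sum]
      exact Finset.sum_congr rfl fun u _ => by ring
    rw [e]
    have h3 : |(s - 1) * (∑ u ∈ words A n, p u * S u - n * I)| ≤ |s - 1| * κ := by
      rw [abs_mul]
      exact mul_le_mul_of_nonneg_left (h.abs_sum_sub_le n) (abs_nonneg _)
    have := (abs_le.1 h3).1
    linarith
  have h4 := (Real.exp_le_exp.2 h2).trans (j.trans (h1.trans
    (mul_le_mul_of_nonneg_left (hQ n) (Real.exp_pos _).le)))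
  have h5 := mul_le_mul_of_nonneg_left h4 (Real.exp_pos (n * P)).le
  calc _ = Real.exp (n * P) * Real.exp (-(|s - 1| * κ) + (s - 1) * (n * I)) := by
        rw [← Real.exp_add, ← Real.exp_add]; congr 1; ring
    _ ≤ _ := h5
    _ = K * (Real.exp (n * P) * Real.exp (κ - n * P) * Real.exp (n * Q)) := by ring
    _ = _ := by
        rw [← Real.exp_add, add_sub_cancel]; ring

/-- The pressure of Gibbs weights dominates that of every sublanguage. -/
lemma IsGibbsWeights.rate_le (h : IsGibbsWeights L S p κ P I) {L' : Set (List A)} (hL : L' ⊆ L)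
    {c Q : ℝ} (hc : 0 < c) (hQ : ∀ n : ℕ, c * Real.exp (n * Q) ≤ part L' S n) : Q ≤ P := by
  refine rate_le_of_forall (c := c) (K := Real.exp κ) hc fun n => (hQ n).trans ?_
  rw [← mul_one (Real.exp κ * _), ← h.sum_eq_one n, Finset.mul_sum, part]
  refine Finset.sum_le_sum fun u hu => ?_
  rw [mem_words] at hu
  by_cases huL : u ∈ L'
  · rw [wt_of_mem huL]
    have := (abs_le.1 (h.abs_log_sub_le u (hL huL))).1
    rw [hu] at this
    rw [← Real.exp_log (h.pos u (hL huL)), ← Real.exp_add, ← Real.exp_add]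
    exact Real.exp_le_exp.2 (by linarith)
  · rw [wt_of_notMem huL]
    have := h.nonneg u
    positivity

end Weights

/-! ### Cylinder masses of Gibbs measures. -/

section Gibbs

variable {A : Type*} [Fintype A] [MeasurableSpace A] [DiscreteMeasurableSpace A]

/-- The measure of the cylinder of a word. -/
noncomputable def mass (ν : Measure (ℕ → A)) (u : List A) : ℝ := ν.real {x | pre u.length x = u}

omit [Fintype A] [DiscreteMeasurableSpace A] in
lemma mass_ofFn (ν : Measure (ℕ → A)) {n : ℕ} (w : Fin (n + 1) → A) :
    mass ν (List.ofFn w) = ν.real (cyl w) := by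
  rw [mass, cyl, List.length_ofFn]
  congr 1
  ext x
  simp only [mem_ofPred_eq]
  rw [← ofFn_word, List.ofFn_injective.eq_iff]

omit [MeasurableSpace A] [DiscreteMeasurableSpace A] in
lemma sum_words_eq_sum_ofFn {M : Type*} [AddCommMonoid M] (n : ℕ) (f : List A → M) :
    ∑ u ∈ words A n, f u = ∑ w : Fin n → A, f (List.ofFn w) := by
  symm
  refine Finset.sum_bij (fun w _ => List.ofFn w) (by simp)
    (fun _ _ _ _ h => List.ofFn_injective h) (fun u hu => ?_) (fun _ _ => rfl)
  rw [mem_words] at hu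
  subst hu
  exact ⟨u.get, Finset.mem_univ _, List.ofFn_get u⟩

omit [Fintype A] [DiscreteMeasurableSpace A] in
lemma measurable_prefix (n : ℕ) : Measurable fun (x : ℕ → A) (i : Fin n) => x i :=
  measurable_pi_lambda _ fun _ => measurable_pi_apply _

omit [Fintype A] [DiscreteMeasurableSpace A] in
lemma measurable_shift : Measurable (shift : (ℕ → A) → ℕ → A) :=
  measurable_pi_lambda _ fun _ => measurable_pi_apply _

lemma measurable_comp_pre (n : ℕ) (g : List A → ℝ) : Measurable fun x : ℕ → A => g (pre n x) := by
  have : (fun x : ℕ → A => g (pre n x)) =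
      (fun w : Fin n → A => g (List.ofFn w)) ∘ fun (x : ℕ → A) (i : Fin n) => x i := by
    ext x
    simp only [Function.comp_apply, ofFn_eq_pre]
  rw [this]
  exact Measurable.of_discrete.comp (measurable_prefix n)

lemma integrable_comp_pre (ν : Measure (ℕ → A)) [IsProbabilityMeasure ν] (n : ℕ)
    (g : List A → ℝ) : Integrable (fun x : ℕ → A => g (pre n x)) ν := by
  refine Integrable.of_bound (measurable_comp_pre n g).aestronglyMeasurable
    (∑ u ∈ words A n, |g u|) (ae_of_all _ fun x => ?_)
  exact Finset.single_le_sum (f := fun u => |g u|) (fun u _ => abs_nonneg _)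
    (mem_words.2 (length_pre n x))

lemma integral_comp_pre (ν : Measure (ℕ → A)) [IsProbabilityMeasure ν] (n : ℕ)
    (g : List A → ℝ) : ∫ x, g (pre n x) ∂ν = ∑ u ∈ words A n, mass ν u * g u := by
  have hm := measurable_prefix (A := A) n
  have : IsProbabilityMeasure (ν.map fun (x : ℕ → A) (i : Fin n) => x i) :=
    Measure.isProbabilityMeasure_map hm.aemeasurable
  have e1 : ∫ x, g (pre n x) ∂ν =
      ∫ w, g (List.ofFn w) ∂(ν.map fun (x : ℕ → A) (i : Fin n) => x i) := by
    rw [integral_map hm.aemeasurable Measurable.of_discrete.aestronglyMeasurable]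
    simp only [ofFn_eq_pre]
  rw [e1, integral_fintype (Integrable.of_finite), sum_words_eq_sum_ofFn]
  refine Finset.sum_congr rfl fun w _ => ?_
  rw [map_measureReal_apply hm (measurableSet_singleton w), smul_eq_mul, mass, List.length_ofFn]
  congr 2
  ext x
  simp only [mem_preimage, mem_singleton_iff, mem_ofPred_eq]
  rw [← ofFn_eq_pre, List.ofFn_injective.eq_iff]

/-- `φ` is a limit of functions of finitely many letters. -/
lemma measurable_of_holder {φ : (ℕ → A) → ℝ} {C θ : ℝ} (h0 : 0 ≤ θ) (h1 : θ < 1)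
    (hφ : ∀ (m : ℕ) (x y : ℕ → A), word x 0 m = word y 0 m → |φ x - φ y| ≤ C * θ ^ m)
    (z : ℕ → A) : Measurable φ := by
  refine measurable_of_tendsto_metrizable
    (fun n => measurable_comp_pre (n + 1) fun u => φ (ap u z)) (tendsto_pi_nhds.2 fun x => ?_)
  rw [tendsto_iff_norm_sub_tendsto_zero]
  refine squeeze_zero (g := fun m => C * θ ^ m) (fun n => norm_nonneg _) (fun n => ?_) ?_
  · refine hφ n _ _ ?_
    rw [word_eq_word_iff]
    have := pre_ap (pre (n + 1) x) z
    rw [length_pre] at this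
    simp [this]
  · simpa using (tendsto_pow_atTop_nhds_zero_of_lt_one h0 h1).const_mul C

/-- The cylinder weights of a Gibbs measure. -/
lemma IsGibbs.exists_isGibbsWeights {Y : Set (ℕ → A)} {φ : (ℕ → A) → ℝ} {C θ : ℝ} (hC : 0 ≤ C)
    (h0 : 0 ≤ θ) (h1 : θ < 1)
    (hφ : ∀ (m : ℕ) (x y : ℕ → A), word x 0 m = word y 0 m → |φ x - φ y| ≤ C * θ ^ m)
    (z : ℕ → A) {ν : Measure (ℕ → A)} (hν : IsGibbs Y φ ν) :
    ∃ κ P I, IsGibbsWeights (lang Y) (suffixSum fun u => φ (ap u z)) (mass ν) κ P I := by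
  obtain ⟨hprob, hinv, hae, K, P, hK, hG⟩ := hν
  set S := suffixSum fun u => φ (ap u z) with hS
  set E := C / (1 - θ) with hE
  have hE0 : 0 ≤ E := div_nonneg hC (by linarith)
  obtain ⟨F, hF⟩ := exists_abs_le_of_holder hφ
  obtain ⟨y, hy⟩ := hae.exists
  have hK1 : 1 ≤ K := by
    have h := (hG y hy 0).1.trans (hG y hy 0).2
    rw [inv_le_iff_one_le_mul₀ hK] at h
    nlinarith
  have hlog : 0 ≤ Real.log K := Real.log_nonneg hK1
  have hnil : mass ν [] = 1 := by simp [mass, pre]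
  have hsum : ∀ n, ∑ u ∈ words A n, mass ν u = 1 := fun n => by
    have := integral_comp_pre ν n fun _ => 1
    simpa using this.symm
  have hgibbs : ∀ u ∈ lang Y, 0 < mass ν u ∧
      |Real.log (mass ν u) - (S u - u.length * P)| ≤ Real.log K + E := by
    rintro u ⟨x, hx, hxu⟩
    cases hu : u.length with
    | zero =>
      rw [List.length_eq_zero_iff] at hu
      subst hu
      rw [hnil]
      simp only [zero_lt_one, Real.log_one, hS, suffixSum, Nat.cast_zero, true_and]
      simpa using add_nonneg hlog hE0
    | succ k =>
      rw [hu] at hxu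
      obtain ⟨g1, g2⟩ := hG x hx k
      rw [← mass_ofFn, ofFn_word, hxu] at g1 g2
      have hb := abs_birkhoff_sub_le hC h0 h1 hφ z x k
      rw [hxu, ← hS] at hb
      set t := birkhoff φ k x - (k + 1) * P with ht
      rw [le_div_iff₀ (Real.exp_pos _)] at g1
      rw [div_le_iff₀ (Real.exp_pos _)] at g2
      have hpos : 0 < mass ν u := lt_of_lt_of_le (by positivity) g1
      refine ⟨hpos, ?_⟩
      have l1 := Real.log_le_log (by positivity) g1
      have l2 := Real.log_le_log hpos g2
      rw [Real.log_mul (by positivity) (Real.exp_ne_zero _), Real.log_exp, Real.log_inv] at l1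
      rw [Real.log_mul (by positivity) (Real.exp_ne_zero _), Real.log_exp] at l2
      push_cast
      rw [abs_le] at *
      constructor <;> linarith
  have hzero : ∀ u, u ∉ lang Y → mass ν u = 0 := by
    intro u hu
    have : ν {x | pre u.length x = u} = 0 := by
      refine measure_mono_null (fun x hx => ?_) (ae_iff.1 hae)
      intro hxY
      exact hu ⟨x, hxY, hx⟩
    simp [mass, measureReal_def, this]
  have hφm := measurable_of_holder h0 h1 hφ z
  have hφi : ∀ i, Integrable (fun x => φ (shift^[i] x)) ν := fun i =>
    Integrable.of_bound (hφm.comp (measurable_shift.iterate i)).aestronglyMeasurable F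
      (ae_of_all _ fun x => hF _)
  -- By invariance the Birkhoff sum over `n` terms has integral `n * ∫ φ`, which identifies `I`.
  have hint : ∀ i, ∫ x, φ (shift^[i] x) ∂ν = ∫ x, φ x ∂ν := by
    intro i
    have hmp := hinv.iterate i
    have := integral_map hmp.measurable.aemeasurable (f := φ) (by
      rw [hmp.map_eq]; exact hφm.aestronglyMeasurable)
    rw [hmp.map_eq] at this
    exact this.symm
  refine ⟨Real.log K + E, P, ∫ x, φ x ∂ν, fun u => measureReal_nonneg, hsum, hzero,
    fun u hu => (hgibbs u hu).1, fun u hu => (hgibbs u hu).2, fun n => ?_⟩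
  cases n with
  | zero => simpa [words_zero, hS, suffixSum] using add_nonneg hlog hE0
  | succ k =>
    have e1 : ∫ x, birkhoff φ k x ∂ν = ((k + 1 : ℕ) : ℝ) * ∫ x, φ x ∂ν := by
      unfold birkhoff
      rw [integral_finsetSum _ fun i _ => hφi i, Finset.sum_congr rfl fun i _ => hint i]
      simp
    have hbi : Integrable (birkhoff φ k) ν := integrable_finsetSum _ fun i _ => hφi i
    rw [← integral_comp_pre, ← e1, ← integral_sub (integrable_comp_pre ν _ _) hbi]
    have := norm_integral_le_of_norm_le_const (μ := ν) (C := E)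
      (f := fun x => S (pre (k + 1) x) - birkhoff φ k x)
      (ae_of_all _ fun x => by
        rw [Real.norm_eq_abs, abs_sub_comm]
        exact abs_birkhoff_sub_le hC h0 h1 hφ z x k)
    rw [Real.norm_eq_abs] at this
    simp only [probReal_univ, mul_one] at this
    linarith

omit [DiscreteMeasurableSpace A] in
lemma hasEntropy_of_isGibbsWeights {ν : Measure (ℕ → A)} {L : Set (List A)} {S : List A → ℝ}
    {κ P I : ℝ} (h : IsGibbsWeights L S (mass ν) κ P I) : HasEntropy ν (P - I) := by
  refine h.tendsto_entropy.congr fun n => ?_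
  rw [sum_words_eq_sum_ofFn]
  simp only [mass_ofFn]

omit [DiscreteMeasurableSpace A] in
lemma hasRelEntropy_of_isGibbsWeights {ν ν' : Measure (ℕ → A)} {X Y : Set (ℕ → A)}
    {S : List A → ℝ} {κ P I κ' P' I' : ℝ} (h : IsGibbsWeights (lang X) S (mass ν) κ P I)
    (h' : IsGibbsWeights (lang Y) S (mass ν') κ' P' I') (hXY : lang X ⊆ lang Y) :
    HasRelEntropy Y ν ν' (P' - P) := by
  classical
  refine (h.tendsto_relEntropy h' hXY).congr fun n => ?_
  rw [Finset.sum_filter, sum_words_eq_sum_ofFn, Finset.sum_filter]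
  simp only [mass_ofFn, ofFn_mem_lang_iff]

end Gibbs

/-! ### Balancing the error terms, and conclusion. -/

/-- A linear function times an exponentially small one is bounded. -/
lemma exists_nat_mul_pow_le {ζ : ℝ} (h0 : 0 < ζ) (h1 : ζ < 1) :
    ∃ M, 1 ≤ M ∧ ∀ m : ℕ, (m : ℝ) * ζ ^ m ≤ M := by
  have h := (tendsto_self_mul_const_pow_of_lt_one h0.le h1).bddAbove_range
  obtain ⟨M, hM⟩ := h
  exact ⟨max M 1, le_max_right _ _, fun m => (hM ⟨m, rfl⟩).trans (le_max_left _ _)⟩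

/-- Choice of the parameter in the comparison of one-sided difference quotients. -/
lemma exists_exponential_bound {K ρ β C θ : ℝ} (hK : 0 < K) (hρ : 0 < ρ) (hρ1 : ρ < 1)
    (hβ : 0 < β) (hC : 0 ≤ C) (h0 : 0 ≤ θ) (h1 : θ < 1) :
    ∃ M > 0, ∃ ζ > 0, ζ < 1 ∧ (∀ m : ℕ, ρ ^ m ≤ ζ ^ m) ∧ ∀ m : ℕ, ∀ x : ℝ,
      (∀ ε : ℝ, |ε| ≤ 1 → |ε| * (β * m) ≤ 1 →
        ε * x ≤ 2 * (ε * (β * m)) ^ 2 + 8 * (C * θ ^ m) + K * ρ ^ m) → |x| ≤ M * ζ ^ m := by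
  set η := max θ ρ with hη
  have hη0 : 0 < η := lt_max_of_lt_right hρ
  have hη1 : η < 1 := max_lt h1 hρ1
  -- With `t = ζ ^ m`, the errors `θ ^ m` and `ρ ^ m` are at most `t ^ 4`. For `ε` of order `t ^ 3`,
  -- dividing by `ε` leaves `t ^ 4 / t ^ 3 = t` from them and `ε * m ^ 2 = O(t)` from the quadratic
  -- term, since `m * t` is bounded.
  set ζ := Real.sqrt (Real.sqrt η) with hζ
  have hζ0 : 0 < ζ := Real.sqrt_pos.2 (Real.sqrt_pos.2 hη0)
  have hζ1 : ζ < 1 := by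
    rw [hζ, Real.sqrt_lt' one_pos, one_pow, Real.sqrt_lt' one_pos, one_pow]
    exact hη1
  have hζ4 : ζ ^ 4 = η := by
    rw [show ζ ^ 4 = (ζ ^ 2) ^ 2 by ring, hζ, Real.sq_sqrt (Real.sqrt_nonneg _),
      Real.sq_sqrt hη0.le]
  have hηζ : η ≤ ζ := by
    rw [← hζ4]; exact pow_le_of_le_one hζ0.le hζ1.le (by norm_num)
  obtain ⟨N, hN1, hN⟩ := exists_nat_mul_pow_le hζ0 hζ1
  -- This factor enforces the constraint `|ε| * (β * m) ≤ 1`.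
  set c := (1 + β * N)⁻¹ with hc
  have hβN : 0 < β * N := by positivity
  have hc0 : 0 < c := by positivity
  have hc1 : c ≤ 1 := inv_le_one_of_one_le₀ (by linarith)
  have hcβ : c * (β * N) ≤ 1 := by
    rw [hc, inv_mul_le_iff₀ (by positivity)]; linarith
  have hcinv : c * (1 + β * N) = 1 := inv_mul_cancel₀ (by positivity)
  refine ⟨2 * (β * N) ^ 2 + (8 * C + K) * (1 + β * N), by positivity, ζ, hζ0, hζ1,
    fun m => pow_le_pow_left₀ hρ.le ((le_max_right _ _).trans hηζ) m, fun m x hx => ?_⟩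
  set t := ζ ^ m with ht
  have ht0 : 0 < t := by positivity
  have ht1 : t ≤ 1 := pow_le_one₀ hζ0.le hζ1.le
  have hmt : m * t ≤ N := hN m
  have hm0 : (0 : ℝ) ≤ m := Nat.cast_nonneg m
  have hθt : θ ^ m ≤ t ^ 4 := by
    rw [ht, ← pow_mul, mul_comm, pow_mul, hζ4]
    exact pow_le_pow_left₀ h0 (le_max_left _ _) m
  have hρt : ρ ^ m ≤ t ^ 4 := by
    rw [ht, ← pow_mul, mul_comm, pow_mul, hζ4]
    exact pow_le_pow_left₀ hρ.le (le_max_right _ _) m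
  set e := c * t ^ 3 with he
  have he0 : 0 < e := by positivity
  have he1 : e ≤ 1 := mul_le_one₀ hc1 (by positivity) (pow_le_one₀ ht0.le ht1)
  have ht3 : t ^ 3 ≤ t := pow_le_of_le_one ht0.le ht1 (by norm_num)
  have heβ : e * (β * m) ≤ 1 := by
    calc e * (β * m) = c * β * (m * t ^ 3) := by rw [he]; ring
      _ ≤ c * β * N := by
        gcongr
        exact le_trans (by gcongr) hmt
      _ ≤ 1 := by linarith
  have key : ∀ y, e * y ≤ 2 * (e * (β * m)) ^ 2 + 8 * (C * θ ^ m) + K * ρ ^ m →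
      y ≤ (2 * (β * N) ^ 2 + (8 * C + K) * (1 + β * N)) * t := by
    intro y hy
    refine le_of_mul_le_mul_left (hy.trans ?_) he0
    have i1 : (e * (β * m)) ^ 2 ≤ e * ((β * N) ^ 2 * t) := by
      have h2 : (m * t) ^ 2 ≤ N ^ 2 := by gcongr
      calc (e * (β * m)) ^ 2 = e * (β ^ 2 * (m * t) ^ 2 * (c * t)) := by rw [he]; ring
        _ ≤ e * (β ^ 2 * N ^ 2 * (1 * t)) := by gcongr
        _ = _ := by ring
    have i2 : 8 * (C * θ ^ m) + K * ρ ^ m ≤ e * ((8 * C + K) * (1 + β * N) * t) := by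
      calc 8 * (C * θ ^ m) + K * ρ ^ m ≤ 8 * (C * t ^ 4) + K * t ^ 4 := by gcongr
        _ = (8 * C + K) * t ^ 4 * (c * (1 + β * N)) := by rw [hcinv]; ring
        _ = _ := by rw [he]; ring
    linarith
  rw [abs_le]
  constructor
  · have := hx (-e) (by rwa [abs_neg, abs_of_pos he0]) (by rwa [abs_neg, abs_of_pos he0])
    have := key (-x) (by linarith)
    linarith
  · exact key x (hx e (by rwa [abs_of_pos he0]) (by rwa [abs_of_pos he0]))

end SoficGibbs

theorem theorem5 {A : Type*} [Fintype A] [TopologicalSpace A] [DiscreteTopology A]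
    [MeasurableSpace A] [DiscreteMeasurableSpace A]
    (X : Set (ℕ → A)) (hne : X.Nonempty) (hX : IsSubshift X) (hsofic : IsSofic X)
    (hspec : IsSpecified X) (φ : (ℕ → A) → ℝ) (hφ : IsHolder φ) :
    ∃ C_h C_P θ_h θ_P : ℝ, 0 < C_h ∧ 0 < C_P ∧ 0 < θ_h ∧ θ_h < 1 ∧ 0 < θ_P ∧ θ_P < 1 ∧
      ∀ μ : Measure (ℕ → A), IsGibbs X φ μ →
      ∀ m : ℕ, 1 ≤ m → ∀ μm : Measure (ℕ → A), IsGibbs (ftApprox X m) φ μm →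
        ∃ h hm r : ℝ, HasEntropy μ h ∧ HasEntropy μm hm ∧ HasRelEntropy (ftApprox X m) μ μm r ∧
          |h - hm| ≤ C_h * θ_h ^ m ∧ r ≤ C_P / (1 - θ_P) * θ_P ^ m := by
  obtain ⟨C, θ, hC, h0, h1, hφ⟩ := hφ
  obtain ⟨z, hz⟩ := hne
  have : Nonempty A := ⟨z 0⟩
  obtain ⟨l, hL⟩ := isGluing_lang ⟨z, hz⟩ hX.2 hspec
  obtain ⟨v, hv⟩ := exists_isSync hX.2 ⟨z, hz⟩ hsofic
  obtain ⟨F, hσ⟩ := exists_isRegular hφ z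
  obtain ⟨P, K, hK, ρ, hρ, hρ1, β, hβ, hP, hsec⟩ := exists_pressure_function hL hv hσ h0 h1
  obtain ⟨M, hM, ζ, hζ, hζ1, hρζ, hbound⟩ :=
    exists_exponential_bound hK hρ hρ1 hβ hC.le h0 h1
  -- The factor `1 - ρ` cancels the denominator in the bound for the relative entropy.
  refine ⟨K + M, K * (1 - ρ), ζ, ρ, by positivity, mul_pos hK (by linarith), hζ, hζ1, hρ, hρ1,
    fun μ hμ m hm μm hμm => ?_⟩
  obtain ⟨κ, Q, I, hw⟩ := hμ.exists_isGibbsWeights hC.le h0 h1 hφ z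
  obtain ⟨κ', Q', I', hw'⟩ := hμm.exists_isGibbsWeights hC.le h0 h1 hφ z
  have hsub : lang X ⊆ lang (ftApprox X m) := fun _ ⟨x, hx, h⟩ =>
    ⟨x, subset_ftApprox hX.2 m hx, h⟩
  have hlow := (hP 1 (by norm_num)).1
  simp only [one_mul] at hlow
  have q1 : P 1 ≤ Q := hw.rate_le Subset.rfl (inv_pos.2 hK) fun n => (hlow n).1
  have q2 : P 1 ≤ Q' := hw'.rate_le hsub (inv_pos.2 hK) fun n => (hlow n).1
  have up : ∀ s : ℝ, |s| ≤ 2 → Q + (s - 1) * I ≤ P s := fun s hs =>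
    hw.le_rate Subset.rfl fun n => ((hP s hs).1 n).2
  have up' : ∀ s : ℝ, |s| ≤ 2 → Q' + (s - 1) * I' ≤ P s + K * ρ ^ m := fun s hs =>
    hw'.le_rate (lang_ftApprox_subset X m) fun n => (hP s hs).2 m n
  have q3 : Q = P 1 := le_antisymm (by simpa using up 1 (by norm_num)) q1
  have q4 : Q' ≤ P 1 + K * ρ ^ m := by simpa using up' 1 (by norm_num)
  have hI : |I' - I| ≤ M * ζ ^ m := by
    -- Supporting lines are compared at `1 + ε` for `X_m` and at `1 - ε` for `X`, with `Q` and `Q'`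
    -- both at least `P 1`; the memory is taken to be `k = m`.
    refine hbound m _ fun ε hε hεm => ?_
    have b1 : |1 + ε| ≤ 2 := by
      have := abs_add_le 1 ε; rw [abs_one] at this; linarith
    have b2 : |1 + -ε| ≤ 2 := by
      have := abs_add_le 1 (-ε); rw [abs_one, abs_neg] at this; linarith
    have u1 := up' _ b1
    have u2 := up _ b2
    have u3 := hsec m hm ε hε hεm
    linarith
  refine ⟨Q - I, Q' - I', Q' - Q, hasEntropy_of_isGibbsWeights hw,
    hasEntropy_of_isGibbsWeights hw', hasRelEntropy_of_isGibbsWeights hw hw' hsub, ?_, ?_⟩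
  · have hQ : |Q - Q'| ≤ K * ζ ^ m := by
      have := mul_le_mul_of_nonneg_left (hρζ m) hK.le
      have : 0 ≤ K * ρ ^ m := by positivity
      rw [_root_.abs_le]
      constructor <;> linarith
    rw [show Q - I - (Q' - I') = (Q - Q') + (I' - I) by ring]
    refine (abs_add_le _ _).trans ?_
    linarith
  · rw [mul_div_assoc, div_self (by linarith), mul_one]
    linarith
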